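/- **Setting.** Time is $t=0,1,2,\dots$; states and actions are $\Theta=A=\{0,1\}$; a belief is the probability of state $1$, and the prior is $\mu_0\in(0,1)$. Taking action $a$ in state $\theta$ at time $t$ gives the decision maker (DM) $u(a,\theta)-ct$, with $c>0$, $u(1,0)=u(0,1)=0$ and $u(0,0),u(1,1)>0$; she is indifferent between the actions at belief $\bar\mu=u(0,0)/(u(0,0)+u(1,1))$. Put $c^*=c/u(0,0)$ and $u^*(\mu)=\max_a\{\mu u(a,1)+(1-\mu)u(a,0)\}$. A dynamic information structure is a distribution over paths of belief-message pairs at times $1,2,\dots$ under which the beliefs, started at $\mu_0$, form a martingale with respect to the natural filtration. Facing it, the DM chooses an optimal stopping time $\tau$ (at time $0$ she knows only the prior) and action $a_\tau$; ties between stopping and waiting are broken in favour of waiting, ties between actions in favour of action $1$. The designer's payoff is $\mathbb E[f(a_\tau,\tau)]$, where $f(1,t)\ge f(0,t)$ for all $t$. A structure is extremal and obedient if its messages are "stop" and "continue", every stop message comes with a belief in $\{0,\bar\mu,1\}$, the belief after a continue message at time $t$ is one deterministic number $\mu^C_t$, and at each time $t\ge1$ the DM optimally stops after a stop message and waits after a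 continue message. An extremal and obedient structure is *almost-geometric bad news* with terminal time $T\in\{0,1,2,\dots\}$ if $\tau\le T$ almost surely, the belief at stopping lies in $\{0,\bar\mu,1\}$ whenever $\tau\geq 1$, and 1. for every $t<T$, if the DM stops at time $t$ then her belief is $0$ (so good news comes only at $T$); 2. for every $2\le t<T$, the probability of stopping at time $t$ with belief $0$, conditional on $\tau>t-1$, is $c^*$; and at every $t<T$ a DM who has not stopped is indifferent between stopping and continuing, i.e. $\mathbb E[(u^*(\mu_t)-ct)\mathbf 1_{\tau>t}]=\mathbb E[(u(a_\tau,\theta)-c\tau)\mathbf 1_{\tau>t}]$. **Proposition.** Suppose $f$ is supermodular ($f(1,t)+f(0,s)\ge f(1,s)+f(0,t)$ for $t\ge s$), $f(1,\cdot)$ is concave, $f(0,\cdot)$ is affine, and the integer condition holds: $\log\mu_1^*/\log(1-c^*)$ is an integer, where $\mu_1^*=\mu_0/(1-c^*)$ if $\mu_0\ge\bar\mu$ and $\mu_1^*=\mu_0/(\mu_0/\bar\mu-c^*)$ if $\mu_0\le\bar\mu$. Then an almost-geometric bad news structure maximizes the designer's payoff over all dynamic information structures. Moreover, if there is a structure under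 which the DM waits at time $0$, then some almost-geometric bad news structure with terminal time $T\ge1$ maximizes the designer's payoff over all structures under which the DM waits at time $0$. -/

import Mathlib

open MeasureTheory

namespace AttentionCapture

/-! States and actions are `0, 1 : Fin 2`, time is `ℕ`, and a belief is identified with the
probability that it gives to state `1`. -/

/-- A path of belief-message pairs at the times `1, 2, 3, …`: the entry `ω t` is the pair
revealed at time `t + 1`. -/
abbrev Path : Type := ℕ → unitInterval × ℝ

/-- The belief process: the prior `μ₀` at time `0`, then the revealed beliefs. -/
def belief (μ₀ : ℝ) : ℕ → Path → ℝ
  | 0, _ => μ₀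
  | t + 1, ω => ((ω t).1 : ℝ)

/-- The natural filtration: at time `t` the pairs of the times `1, …, t` are known. -/
def history : Filtration ℕ (inferInstance : MeasurableSpace Path) where
  seq t := MeasurableSpace.comap (fun (ω : Path) (s : Fin t) => ω s) inferInstance
  mono' := by
    intro i j hij
    have h : (fun (ω : Path) (s : Fin i) => ω s)
        = (fun (x : Fin j → unitInterval × ℝ) (s : Fin i) => x (Fin.castLE hij s)) ∘
          (fun (ω : Path) (s : Fin j) => ω s) := rfl
    simp only
    rw [h, ← MeasurableSpace.comap_comp]
    exact MeasurableSpace.comap_mono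
      (measurable_pi_lambda _ fun s => measurable_pi_apply _).comap_le
  le' := by
    intro i
    exact (measurable_pi_lambda _ fun s => measurable_pi_apply _).comap_le

/-- A dynamic information structure with prior `μ₀`: a distribution over paths of belief-message
pairs under which the belief process is a martingale. -/
structure InfoStructure (μ₀ : ℝ) where
  law : Measure Path
  isProb : IsProbabilityMeasure law
  martingale : Martingale (belief μ₀) history law

/-- A strategy of the DM: a stopping time of the natural filtration and an action that is
measurable with respect to the information at the stopping time. Strategies with infinite expected
waiting time have payoff `-∞` and are left out; in particular `τ` is almost surely finite. -/
structure Strategy {μ₀ : ℝ} (I : InfoStructure μ₀) where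
  τ : Path → ℕ∞
  act : Path → Fin 2
  isStopping : IsStoppingTime history τ
  measurable_act : Measurable[isStopping.measurableSpace] act
  finite_wait : ∫⁻ ω, (τ ω : ENNReal) ∂I.law ≠ ⊤

/-- Expected utility of action `a` at belief `μ`; `u a θ` is the utility of `a` in state `θ`. -/
def expUtility (u : Fin 2 → Fin 2 → ℝ) (a : Fin 2) (μ : ℝ) : ℝ :=
  μ * u a 1 + (1 - μ) * u a 0

/-- The payoff from stopping at belief `μ` and taking a best action. -/
def stopUtility (u : Fin 2 → Fin 2 → ℝ) (μ : ℝ) : ℝ :=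
  max (expUtility u 0 μ) (expUtility u 1 μ)

/-- The belief at which the DM is indifferent between the two actions, under the normalization
`u 1 0 = u 0 1 = 0`. -/
noncomputable def indiffBelief (u : Fin 2 → Fin 2 → ℝ) : ℝ :=
  u 0 0 / (u 0 0 + u 1 1)

namespace Strategy

variable {μ₀ : ℝ} {I : InfoStructure μ₀}

/-- The stopping time as a natural number (on the null set where it is infinite, `0`). -/
noncomputable def time (σ : Strategy I) (ω : Path) : ℕ := (σ.τ ω).toNat

/-- The belief at which the DM stops. -/
noncomputable def stopBelief (σ : Strategy I) (ω : Path) : ℝ := belief μ₀ (σ.time ω) ω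

/-- The payoff of the DM along a path: utility of the action at the stopping belief, net of the
cost `c` per period of waiting. -/
noncomputable def pathPayoff (u : Fin 2 → Fin 2 → ℝ) (c : ℝ) (σ : Strategy I) (ω : Path) : ℝ :=
  expUtility u (σ.act ω) (σ.stopBelief ω) - c * σ.time ω

/-- The expected payoff of the DM. -/
noncomputable def payoff (u : Fin 2 → Fin 2 → ℝ) (c : ℝ) (σ : Strategy I) : ℝ :=
  ∫ ω, σ.pathPayoff u c ω ∂I.law

/-- The expected payoff of a designer with preferences `f` over actions and stopping times. -/
noncomputable def designerPayoff (f : Fin 2 → ℕ → ℝ) (σ : Strategy I) : ℝ :=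
  ∫ ω, f (σ.act ω) (σ.time ω) ∂I.law

/-- `σ` solves the problem of a DM who has waited until time `n`: it is optimal among the
strategies that do not stop before `n`, ties between stopping and waiting are broken in favour of
waiting, and ties between the actions in favour of action `1`. -/
structure IsResponseFrom (u : Fin 2 → Fin 2 → ℝ) (c : ℝ) (n : ℕ) (σ : Strategy I) : Prop where
  start : ∀ ω, (n : ℕ∞) ≤ σ.τ ω
  optimal : ∀ σ' : Strategy I, (∀ ω, (n : ℕ∞) ≤ σ'.τ ω) → σ'.payoff u c ≤ σ.payoff u c
  waits : ∀ σ' : Strategy I, (∀ ω, (n : ℕ∞) ≤ σ'.τ ω) → σ'.payoff u c = σ.payoff u c →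
    ∀ᵐ ω ∂I.law, σ'.τ ω ≤ σ.τ ω
  actsOne : ∀ᵐ ω ∂I.law,
    expUtility u 0 (σ.stopBelief ω) ≤ expUtility u 1 (σ.stopBelief ω) → σ.act ω = 1

/-- `σ` is the behaviour of the DM facing the information structure `I`. -/
def IsResponse (u : Fin 2 → Fin 2 → ℝ) (c : ℝ) (σ : Strategy I) : Prop :=
  σ.IsResponseFrom u c 0

end Strategy

/-- Extremal and obedient structures. The messages are `1` ("stop") and `0` ("continue"); a stop
message comes with a belief in `{0, μ̄, 1}`, a continue message with the belief prescribed by one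
deterministic path `μC`; and at each time `t + 1` a DM who has waited until then stops after a
stop message and waits after a continue message. -/
structure IsExtremalObedient (u : Fin 2 → Fin 2 → ℝ) (c : ℝ) {μ₀ : ℝ} (I : InfoStructure μ₀) :
    Prop where
  extremal : ∃ μC : ℕ → ℝ, ∀ᵐ ω ∂I.law, ∀ t : ℕ,
    ((ω t).2 = 1 ∧ belief μ₀ (t + 1) ω ∈ ({0, indiffBelief u, 1} : Set ℝ)) ∨
    ((ω t).2 = 0 ∧ belief μ₀ (t + 1) ω = μC (t + 1))
  obedient : ∀ t : ℕ, ∃ σ : Strategy I, σ.IsResponseFrom u c (t + 1) ∧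
    ∀ᵐ ω ∂I.law, ((ω t).2 = 1 → σ.τ ω = (t + 1 : ℕ)) ∧ ((ω t).2 = 0 → (t + 1 : ℕ) < σ.τ ω)

/-- The structure `I`, to which the DM responds with `σ`, is almost-geometric bad news with
terminal time `T`. -/
structure IsAlmostGeometric (u : Fin 2 → Fin 2 → ℝ) (c : ℝ) {μ₀ : ℝ} {I : InfoStructure μ₀}
    (σ : Strategy I) (T : ℕ) : Prop where
  extremalObedient : IsExtremalObedient u c I
  /-- The DM stops at time `T` at the latest. -/
  terminal : ∀ᵐ ω ∂I.law, σ.τ ω ≤ T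
  /-- The belief at which the DM stops after time `0` is extremal. -/
  stopBelief_mem : ∀ᵐ ω ∂I.law, 0 < σ.τ ω →
    σ.stopBelief ω ∈ ({0, indiffBelief u, 1} : Set ℝ)
  /-- Before time `T` the DM stops only on conclusive bad news. -/
  badNews : ∀ t < T, ∀ᵐ ω ∂I.law, σ.τ ω = t → belief μ₀ t ω = 0
  /-- At each time `t + 1` with `2 ≤ t + 1 < T` bad news arrives with probability `c / u 0 0`,
  conditional on not having stopped by time `t`. -/
  rate : ∀ t : ℕ, 1 ≤ t → t + 1 < T →
    I.law.real {ω | σ.τ ω = (t + 1 : ℕ) ∧ belief μ₀ (t + 1) ω = 0} / I.law.real {ω | t < σ.τ ω}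
      = c / u 0 0
  /-- At each time `t < T`, a DM who has not stopped is indifferent between stopping and
  continuing. -/
  indifferent : ∀ t < T,
    ∫ ω in {ω | t < σ.τ ω}, (stopUtility u (belief μ₀ t ω) - c * t) ∂I.law
      = ∫ ω in {ω | t < σ.τ ω}, σ.pathPayoff u c ω ∂I.law

/-- The belief `μ₁*`, with `c* = c / u 0 0`. -/
noncomputable def firstBelief (u : Fin 2 → Fin 2 → ℝ) (c μ₀ : ℝ) : ℝ :=
  if indiffBelief u ≤ μ₀ then μ₀ / (1 - c / u 0 0)
  else μ₀ / (μ₀ / indiffBelief u - c / u 0 0)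

/-- The integer condition: `log μ₁* / log (1 - c*)` is an integer. -/
def IntegerCondition (u : Fin 2 → Fin 2 → ℝ) (c μ₀ : ℝ) : Prop :=
  ∃ n : ℤ, Real.log (firstBelief u c μ₀) / Real.log (1 - c / u 0 0) = n

end AttentionCapture

namespace AttentionCapture

/-! ### Concave sequences and geometric interpolation -/

/-- A concave nondecreasing sequence lies below its chords when time is measured on a
geometric scale. -/
theorem le_geometric_chord {g : ℕ → ℝ} {r : ℝ} (hr : 1 < r)
    (hmono : ∀ t, g t ≤ g (t + 1))
    (hconc : ∀ t, g (t + 2) - g (t + 1) ≤ g (t + 1) - g t) (j t : ℕ) :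
    g t ≤ g j + (g (j + 1) - g j) / (r ^ (j + 1) - r ^ j) * (r ^ t - r ^ j) := by
  have hr0 : 0 < r := by linarith
  have hpos : ∀ i, 0 < r ^ (i + 1) - r ^ i := fun i => by
    rw [pow_succ]; nlinarith [pow_pos hr0 i]
  have hanti : ∀ i, (g (i + 2) - g (i + 1)) / (r ^ (i + 2) - r ^ (i + 1))
      ≤ (g (i + 1) - g i) / (r ^ (i + 1) - r ^ i) := fun i => by
    refine div_le_div₀ (by linarith [hmono i]) (hconc i) (hpos i) ?_
    have := hpos i
    have h2 : r ^ (i + 2) - r ^ (i + 1) = r * (r ^ (i + 1) - r ^ i) := by ring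
    rw [h2]; nlinarith
  have hslope : Antitone fun i => (g (i + 1) - g i) / (r ^ (i + 1) - r ^ i) :=
    antitone_nat_of_succ_le hanti
  set q := (g (j + 1) - g j) / (r ^ (j + 1) - r ^ j) with hq
  rcases le_total j t with h | h
  · induction t, h using Nat.le_induction with
    | base => simp
    | succ t ht ih =>
      have h1 := hslope ht
      simp only [← hq] at h1
      rw [div_le_iff₀ (hpos t)] at h1
      linarith
  · induction h using Nat.decreasingInduction with
    | self => simp
    | of_succ t ht ih =>
      have h1 := hslope ht.le
      simp only [← hq] at h1
      rw [le_div_iff₀ (hpos t)] at h1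
      linarith

/-- A sequence of affine bounds, the `j`-th of which interpolates `J` between `x j` and
`x (j + 1)`, is at some node below `J`. -/
theorem exists_le_of_interpolation {J x : ℕ → ℝ} {v y : ℝ} {n : ℕ}
    (hlow : x n ≤ y) (hup : y ≤ x 0)
    (a b : ℕ → ℝ) (hv : ∀ j, v ≤ a j + b j * y) (hJ : ∀ j, a j + b j * x j = J j)
    (hJ' : ∀ j, a j + b j * x (j + 1) = J (j + 1)) :
    ∃ j ≤ n, v ≤ J j := by
  induction n with
  | zero =>
    have : y = x 0 := le_antisymm hup hlow
    exact ⟨0, le_rfl, by rw [← hJ 0, ← this]; exact hv 0⟩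
  | succ n ih =>
    by_cases h : x n ≤ y
    · obtain ⟨j, hj, hj'⟩ := ih h
      exact ⟨j, hj.trans n.le_succ, hj'⟩
    · push Not at h
      rcases le_total 0 (b n) with hb | hb
      · refine ⟨n, n.le_succ, (hv n).trans ?_⟩
        rw [← hJ n]; gcongr
      · refine ⟨n + 1, le_rfl, (hv n).trans ?_⟩
        rw [← hJ' n]
        linarith [mul_le_mul_of_nonpos_left hlow hb]

/-! ### Beliefs, histories and strategies -/

theorem measurable_belief_history (μ₀ : ℝ) (t : ℕ) : Measurable[history t] (belief μ₀ t) := by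
  cases t with
  | zero => exact measurable_const
  | succ t =>
    have h : belief μ₀ (t + 1)
        = (fun x : Fin (t + 1) → unitInterval × ℝ => ((x (Fin.last t)).1 : ℝ)) ∘
          (fun (ω : Path) (s : Fin (t + 1)) => ω s) := rfl
    rw [h]
    exact (measurable_subtype_coe.comp (measurable_fst.comp (measurable_pi_apply _))).comp
      (comap_measurable _)

theorem measurable_belief (μ₀ : ℝ) (t : ℕ) : Measurable (belief μ₀ t) :=
  (measurable_belief_history μ₀ t).mono (history.le t) le_rfl

theorem belief_mem_Icc {μ₀ : ℝ} (h0 : 0 ≤ μ₀) (h1 : μ₀ ≤ 1) (t : ℕ) (ω : Path) :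
    belief μ₀ t ω ∈ Set.Icc (0 : ℝ) 1 := by
  cases t with
  | zero => exact ⟨h0, h1⟩
  | succ t => exact (ω t).1.2

/-- Two paths that agree up to time `t` cannot be told apart at time `t`. -/
theorem mem_iff_of_agree {t : ℕ} {s : Set Path} (hs : MeasurableSet[history t] s) {ω ω' : Path}
    (h : ∀ i < t, ω i = ω' i) : ω ∈ s ↔ ω' ∈ s := by
  obtain ⟨s', -, rfl⟩ := hs
  have : (fun i : Fin t => ω i) = fun i : Fin t => ω' i := funext fun i => h i i.2
  simp only [Set.mem_preimage, this]

/-- A bounded stopping time, together with the best action at the stopping belief (action `1` in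
case of a tie). -/
noncomputable def bestReply {μ₀ : ℝ} (I : InfoStructure μ₀) (u : Fin 2 → Fin 2 → ℝ)
    (τ : Path → ℕ) (hτ : ∀ i, MeasurableSet[history i] {ω | τ ω ≤ i}) (B : ℕ)
    (hB : ∀ ω, τ ω ≤ B) : Strategy I where
  τ ω := (τ ω : ℕ∞)
  act ω := if expUtility u 0 (belief μ₀ (τ ω) ω) ≤ expUtility u 1 (belief μ₀ (τ ω) ω)
    then 1 else 0
  isStopping i := by
    convert hτ i using 3 with ω
    exact Nat.cast_le (α := ℕ∞)
  measurable_act := by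
    have hst : IsStoppingTime history fun ω => (τ ω : ℕ∞) := fun i => by
      convert hτ i using 3 with ω
      exact Nat.cast_le (α := ℕ∞)
    have hmeas : ∀ t, MeasurableSet[history t]
        {ω | expUtility u 0 (belief μ₀ t ω) ≤ expUtility u 1 (belief μ₀ t ω)} := fun t => by
      have hb := measurable_belief_history μ₀ t
      unfold expUtility
      have hm : ∀ a, Measurable[history t] fun ω =>
          belief μ₀ t ω * u a 1 + (1 - belief μ₀ t ω) * u a 0 := fun a =>
        (hb.mul_const _).add ((measurable_const.sub hb).mul_const _)
      exact measurableSet_le (hm 0) (hm 1)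
    have heq : ∀ t, MeasurableSet[history t] {ω | τ ω = t} := fun t => by
      have := hst.measurableSet_eq t
      convert this using 3 with ω
      exact (Nat.cast_inj (R := ℕ∞)).symm
    have hset : MeasurableSet[hst.measurableSpace]
        {ω | expUtility u 0 (belief μ₀ (τ ω) ω) ≤ expUtility u 1 (belief μ₀ (τ ω) ω)} := by
      have key : ∀ i, MeasurableSet[history i]
          ({ω | expUtility u 0 (belief μ₀ (τ ω) ω) ≤ expUtility u 1 (belief μ₀ (τ ω) ω)}
            ∩ {ω | τ ω ≤ i}) := fun i => by
        have : {ω | expUtility u 0 (belief μ₀ (τ ω) ω) ≤ expUtility u 1 (belief μ₀ (τ ω) ω)}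
            ∩ {ω | τ ω ≤ i} = ⋃ t ∈ Set.Iic i,
              {ω | expUtility u 0 (belief μ₀ t ω) ≤ expUtility u 1 (belief μ₀ t ω)}
                ∩ {ω | τ ω = t} := by
          ext ω
          simp only [Set.mem_inter_iff, Set.mem_ofPred_eq, Set.mem_iUnion, Set.mem_Iic,
            exists_prop]
          constructor
          · rintro ⟨h, h'⟩
            exact ⟨τ ω, h', h, rfl⟩
          · rintro ⟨t, ht, h, rfl⟩
            exact ⟨h, ht⟩
        rw [this]
        exact MeasurableSet.biUnion (Set.to_countable _) fun t ht =>
          history.mono ht _ ((hmeas t).inter (heq t))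
      refine ⟨?_, fun i => ?_⟩
      · have h := key B
        rw [show {ω | τ ω ≤ B} = Set.univ from Set.eq_univ_of_forall hB, Set.inter_univ] at h
        exact le_iSup history B _ h
      · convert key i using 3
        ext ω
        exact Nat.cast_le (α := ℕ∞)
    exact Measurable.ite hset measurable_const measurable_const
  finite_wait := by
    have := I.isProb
    refine ne_of_lt (lt_of_le_of_lt (lintegral_mono (g := fun _ => (B : ENNReal)) fun ω => ?_) ?_)
    · simpa using hB ω
    · simp

namespace Strategy

variable {μ₀ : ℝ} {I : InfoStructure μ₀} (σ : Strategy I)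

theorem measurableSet_lt (t : ℕ) : MeasurableSet[history t] {ω | (t : ℕ∞) < σ.τ ω} := by
  have := (σ.isStopping.measurableSet_le t).compl
  convert this using 1
  ext ω
  exact (@not_le ℕ∞ _ _ _).symm

/-- At time `0` the DM knows nothing, so she either stops on all paths or waits on all paths. -/
theorem stops_or_waits : (∀ ω, σ.τ ω = 0) ∨ ∀ ω, 0 < σ.τ ω := by
  by_cases h : ∃ ω, σ.τ ω = 0
  · obtain ⟨ω, hω⟩ := h
    left
    intro ω'
    have := (mem_iff_of_agree (σ.measurableSet_lt 0) (ω := ω) (ω' := ω') (by simp))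
    simpa [hω] using this
  · push Not at h
    exact Or.inr fun ω => pos_of_ne_zero (h ω)

theorem measurable_τ : Measurable σ.τ :=
  ENat.measurable_iff.2 fun t => history.le t _ (σ.isStopping.measurableSet_eq t)

theorem measurable_time : Measurable σ.time :=
  (Measurable.of_discrete (f := ENat.toNat)).comp σ.measurable_τ

theorem measurable_action : Measurable σ.act :=
  σ.measurable_act.mono σ.isStopping.measurableSpace_le le_rfl

theorem measurable_stopBelief : Measurable σ.stopBelief := by
  have h : Measurable fun p : ℕ × Path => belief μ₀ p.1 p.2 :=
    measurable_from_prod_countable_right fun t => measurable_belief μ₀ t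
  exact h.comp (σ.measurable_time.prodMk measurable_id)

theorem ae_finite : ∀ᵐ ω ∂I.law, σ.τ ω = (σ.time ω : ℕ∞) := by
  have h := ae_lt_top' (f := fun ω => (σ.τ ω : ENNReal)) (μ := I.law) ?_ σ.finite_wait
  · filter_upwards [h] with ω hω
    exact (ENat.natCast_toNat fun htop => by simp [htop] at hω).symm
  · exact ((Measurable.of_discrete (f := ENat.toENNReal)).comp σ.measurable_τ).aemeasurable

theorem integrable_time : Integrable (fun ω => (σ.time ω : ℝ)) I.law := by
  refine ⟨(measurable_from_top.comp σ.measurable_time).aestronglyMeasurable, ?_⟩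
  refine lt_of_le_of_lt (lintegral_mono (g := fun ω => (σ.τ ω : ENNReal)) fun ω => ?_)
    (lt_top_iff_ne_top.2 σ.finite_wait)
  simp only [time]
  rcases eq_or_ne (σ.τ ω) ⊤ with h | h
  · simp [h]
  · obtain ⟨n, hn⟩ := ENat.ne_top_iff_exists.1 h
    simp [← hn]

end Strategy
namespace Strategy

variable {μ₀ : ℝ} {I : InfoStructure μ₀} (σ : Strategy I)

theorem bestReply_time (u : Fin 2 → Fin 2 → ℝ) (τ : Path → ℕ)
    (hτ : ∀ i, MeasurableSet[history i] {ω | τ ω ≤ i}) (B : ℕ) (hB : ∀ ω, τ ω ≤ B) (ω : Path) :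
    (bestReply I u τ hτ B hB).time ω = τ ω :=
  ENat.toNat_natCast _

theorem bestReply_act (u : Fin 2 → Fin 2 → ℝ) (τ : Path → ℕ)
    (hτ : ∀ i, MeasurableSet[history i] {ω | τ ω ≤ i}) (B : ℕ) (hB : ∀ ω, τ ω ≤ B) (ω : Path) :
    (bestReply I u τ hτ B hB).act ω
      = if expUtility u 0 (belief μ₀ (τ ω) ω) ≤ expUtility u 1 (belief μ₀ (τ ω) ω)
        then 1 else 0 :=
  rfl

theorem bestReply_pathPayoff (u : Fin 2 → Fin 2 → ℝ) (c : ℝ) (τ : Path → ℕ)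
    (hτ : ∀ i, MeasurableSet[history i] {ω | τ ω ≤ i}) (B : ℕ) (hB : ∀ ω, τ ω ≤ B) (ω : Path) :
    (bestReply I u τ hτ B hB).pathPayoff u c ω
      = stopUtility u (belief μ₀ (τ ω) ω) - c * τ ω := by
  simp only [pathPayoff, stopBelief, bestReply_time, bestReply_act, stopUtility]
  split_ifs with h
  · rw [max_eq_right h]
  · rw [max_eq_left (not_le.1 h).le]

/-! ### Integrability and optional stopping -/

theorem stopBelief_mem_Icc (h0 : 0 ≤ μ₀) (h1 : μ₀ ≤ 1) (ω : Path) :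
    σ.stopBelief ω ∈ Set.Icc (0 : ℝ) 1 :=
  belief_mem_Icc h0 h1 _ ω

theorem integrable_of_bounded {μ : Measure Path} [IsFiniteMeasure μ] {g : Path → ℝ}
    (hg : Measurable g) (C : ℝ) (h : ∀ ω, |g ω| ≤ C) : Integrable g μ :=
  Integrable.of_bound hg.aestronglyMeasurable C (Filter.Eventually.of_forall h)

theorem integrable_stopBelief (h0 : 0 ≤ μ₀) (h1 : μ₀ ≤ 1) : Integrable σ.stopBelief I.law := by
  have := I.isProb
  refine integrable_of_bounded σ.measurable_stopBelief 1 fun ω => ?_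
  have := σ.stopBelief_mem_Icc h0 h1 ω
  exact abs_le.2 ⟨by linarith [this.1], this.2⟩

theorem integrable_action_mul (h : Fin 2 → ℝ) {g : Path → ℝ} (hg : Integrable g I.law) :
    Integrable (fun ω => h (σ.act ω) * g ω) I.law := by
  have hm : Measurable fun ω => h (σ.act ω) := (measurable_of_finite h).comp σ.measurable_action
  refine hg.bdd_mul (c := |h 0| + |h 1|) hm.aestronglyMeasurable
    (Filter.Eventually.of_forall fun ω => ?_)
  have : ∀ a : Fin 2, |h a| ≤ |h 0| + |h 1| := by
    intro a; fin_cases a <;> simp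
  exact this _

theorem integrable_pathPayoff (h0 : 0 ≤ μ₀) (h1 : μ₀ ≤ 1) (u : Fin 2 → Fin 2 → ℝ) (c : ℝ) :
    Integrable (σ.pathPayoff u c) I.law := by
  have := I.isProb
  have hb := σ.integrable_stopBelief h0 h1
  have := ((σ.integrable_action_mul (fun a => u a 1) hb).add
    (σ.integrable_action_mul (fun a => u a 0) ((integrable_const (1 : ℝ)).sub hb))).sub
      (σ.integrable_time.const_mul c)
  refine this.congr (Filter.Eventually.of_forall fun ω => ?_)
  simp [pathPayoff, expUtility]
  ring

/-- Optional stopping: on the event that the DM has not stopped by time `t`, the belief at stopping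
is on average the belief at time `t`. -/
theorem setIntegral_stopBelief (h0 : 0 ≤ μ₀) (h1 : μ₀ ≤ 1) (t : ℕ) :
    ∫ ω in {ω | (t : ℕ∞) < σ.τ ω}, σ.stopBelief ω ∂I.law
      = ∫ ω in {ω | (t : ℕ∞) < σ.τ ω}, belief μ₀ t ω ∂I.law := by
  have := I.isProb
  set E : Set Path := {ω | (t : ℕ∞) < σ.τ ω} with hE
  have hEm : MeasurableSet E := history.le t _ (σ.measurableSet_lt t)
  let m : ℕ → Path → ℕ := fun n ω => (min (σ.τ ω) n).toNat
  have hmm : ∀ n, Measurable (m n) := fun n =>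
    (Measurable.of_discrete (f := fun x : ℕ∞ => (min x n).toNat)).comp σ.measurable_τ
  have hbm : ∀ n, Measurable fun ω => belief μ₀ (m n ω) ω := fun n => by
    have h : Measurable fun p : ℕ × Path => belief μ₀ p.1 p.2 :=
      measurable_from_prod_countable_right fun t => measurable_belief μ₀ t
    exact h.comp ((hmm n).prodMk measurable_id)
  have hbd : ∀ n ω, ‖belief μ₀ (m n ω) ω‖ ≤ 1 := fun n ω => by
    have := belief_mem_Icc h0 h1 (m n ω) ω
    exact abs_le.2 ⟨by linarith [this.1], this.2⟩
  have hbi : ∀ n, Integrable (fun ω => belief μ₀ (m n ω) ω) I.law := fun n =>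
    integrable_of_bounded (hbm n) 1 (hbd n)
  have hmi : ∀ n, Integrable (belief μ₀ n) I.law := fun n => I.martingale.integrable n
  have hstep : ∀ n, t ≤ n → ∫ ω in E, belief μ₀ (m n ω) ω ∂I.law
      = ∫ ω in E, belief μ₀ t ω ∂I.law := by
    intro n hn
    induction n, hn using Nat.le_induction with
    | base =>
      refine setIntegral_congr_fun hEm fun ω hω => ?_
      have : m t ω = t := by
        simp only [m, min_eq_right (le_of_lt (show (t : ℕ∞) < σ.τ ω from hω)), ENat.toNat_natCast]
      simp only [this]
    | succ n hn ih =>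
      rw [← ih]
      set F : Set Path := {ω | (n : ℕ∞) < σ.τ ω} with hF
      have hFm : MeasurableSet F := history.le n _ (σ.measurableSet_lt n)
      have hsub : F ⊆ E := fun ω hω =>
        lt_of_le_of_lt (show (t : ℕ∞) ≤ n from Nat.cast_le.2 hn) hω
      have hdiff : ∀ ω, belief μ₀ (m (n + 1) ω) ω - belief μ₀ (m n ω) ω
          = F.indicator (fun ω => belief μ₀ (n + 1) ω - belief μ₀ n ω) ω := by
        intro ω
        by_cases hω : ω ∈ F
        · have h1 : m n ω = n := by
            simp only [m, min_eq_right (le_of_lt (show (n : ℕ∞) < σ.τ ω from hω)),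
              ENat.toNat_natCast]
          have h2 : m (n + 1) ω = n + 1 := by
            have : ((n + 1 : ℕ) : ℕ∞) ≤ σ.τ ω := by
              push_cast; exact Order.add_one_le_of_lt hω
            simp only [m, min_eq_right this, ENat.toNat_natCast]
          rw [Set.indicator_of_mem hω, h1, h2]
        · have hle : σ.τ ω ≤ n := not_lt.1 hω
          have h1 : m n ω = m (n + 1) ω := by
            simp only [m, min_eq_left hle,
              min_eq_left (hle.trans (Nat.cast_le.2 n.le_succ))]
          rw [Set.indicator_of_notMem hω, h1, sub_self]
      have h0 : ∫ ω in E, (belief μ₀ (m (n + 1) ω) ω - belief μ₀ (m n ω) ω) ∂I.law = 0 := by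
        simp only [hdiff]
        rw [setIntegral_indicator hFm, Set.inter_eq_right.2 hsub,
          integral_sub (hmi _).integrableOn (hmi _).integrableOn,
          ← I.martingale.setIntegral_eq n.le_succ (σ.measurableSet_lt n), sub_self]
      rw [integral_sub (hbi _).integrableOn (hbi _).integrableOn] at h0
      linarith
  have hlim : Filter.Tendsto (fun n => ∫ ω in E, belief μ₀ (m n ω) ω ∂I.law) Filter.atTop
      (nhds (∫ ω in E, σ.stopBelief ω ∂I.law)) := by
    refine tendsto_integral_of_dominated_convergence (fun _ => (1 : ℝ))
      (fun n => (hbm n).aestronglyMeasurable) (integrable_const _)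
      (fun n => Filter.Eventually.of_forall (hbd n)) ?_
    filter_upwards [ae_restrict_of_ae σ.ae_finite] with ω hω
    refine tendsto_const_nhds.congr' ?_
    filter_upwards [Filter.eventually_ge_atTop (σ.time ω)] with n hn
    have : m n ω = σ.time ω := by
      simp only [m]
      rw [hω, min_eq_left (Nat.cast_le.2 hn), ENat.toNat_natCast]
    rw [this]; rfl
  refine tendsto_nhds_unique hlim (tendsto_const_nhds.congr' ?_)
  filter_upwards [Filter.eventually_ge_atTop t] with n hn
  exact (hstep n hn).symm

/-- Behave as `σ` until time `t`, when those who have not stopped yet stop and take action `1`. -/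
noncomputable def truncate (t : ℕ) : Strategy I where
  τ ω := min (σ.τ ω) t
  act ω := if (t : ℕ∞) < σ.τ ω then 1 else σ.act ω
  isStopping := σ.isStopping.min_const t
  measurable_act := by
    intro s hs
    have hpre : (fun ω => if (t : ℕ∞) < σ.τ ω then 1 else σ.act ω) ⁻¹' s
        = ({ω | (t : ℕ∞) < σ.τ ω} ∩ {_ω | (1 : Fin 2) ∈ s}) ∪ (σ.act ⁻¹' s ∩ {ω | σ.τ ω ≤ t}) := by
      ext ω
      by_cases h : (t : ℕ∞) < σ.τ ω
      · simp [h]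
      · simp [h, not_lt.1 h]
    rw [hpre]
    have hact := σ.measurable_act hs
    have hconst : ∀ m : MeasurableSpace Path, MeasurableSet[m] {_ω : Path | (1 : Fin 2) ∈ s} :=
      fun m => @MeasurableSet.const _ m _
    exact (σ.isStopping.measurableSet_min_const_iff _).2
      ⟨((σ.isStopping.measurableSet_gt' t).inter (hconst _)).union
        (hact.inter (σ.isStopping.measurableSet_le' t)),
      ((σ.measurableSet_lt t).inter (hconst _)).union (hact.2 t)⟩
  finite_wait := by
    refine ne_top_of_le_ne_top σ.finite_wait (lintegral_mono fun ω => ?_)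
    exact ENat.toENNReal_le.2 (min_le_left _ _)

/-! ### Implications of obedience -/

theorem one_le_integral_time {σ : Strategy I} (hwait : ∀ ω, 0 < σ.τ ω) :
    1 ≤ ∫ ω, (σ.time ω : ℝ) ∂I.law := by
  have := I.isProb
  have hpos : ∀ᵐ ω ∂I.law, (1 : ℝ) ≤ σ.time ω := by
    filter_upwards [σ.ae_finite] with ω hω
    have := hwait ω
    rw [hω] at this
    exact Nat.one_le_cast.2 (Nat.cast_pos.1 this)
  simpa using integral_mono_ae (integrable_const _) σ.integrable_time hpos

/-- A DM who waits at time `t` must expect to take action `0` often enough. -/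
theorem IsResponse.cost_le {u : Fin 2 → Fin 2 → ℝ} {c : ℝ} {σ : Strategy I}
    (h : σ.IsResponse u c) (h0 : 0 ≤ μ₀) (h1 : μ₀ ≤ 1) (hu10 : u 1 0 = 0) (hu01 : u 0 1 = 0)
    (hu00 : 0 < u 0 0) (hu11 : 0 < u 1 1) (t : ℕ) :
    c * ∫ ω, ((σ.time ω - t : ℕ) : ℝ) ∂I.law
      ≤ u 0 0 * ∫ ω, (if t < σ.time ω ∧ σ.act ω = 0 then (1 : ℝ) else 0) ∂I.law := by
  have := I.isProb
  set E : Set Path := {ω | (t : ℕ∞) < σ.τ ω} with hE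
  have hEm : MeasurableSet E := history.le t _ (σ.measurableSet_lt t)
  have hopt := h.optimal (σ.truncate t) fun ω => by simp
  have hpi := σ.integrable_pathPayoff h0 h1 u c
  have hpi' := (σ.truncate t).integrable_pathPayoff h0 h1 u c
  have hbi := σ.integrable_stopBelief h0 h1
  have hmi : Integrable (belief μ₀ t) I.law := I.martingale.integrable t
  have hEt : ∀ᵐ ω ∂I.law, (ω ∈ E ↔ t < σ.time ω) := by
    filter_upwards [σ.ae_finite] with ω hω
    simp only [hE, Set.mem_ofPred_eq, hω]
    exact Nat.cast_lt
  have hdiff : ∀ ω, σ.pathPayoff u c ω - (σ.truncate t).pathPayoff u c ω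
      = E.indicator (fun ω => σ.pathPayoff u c ω - (belief μ₀ t ω * u 1 1 - c * t)) ω := by
    intro ω
    by_cases hω : ω ∈ E
    · have ht : (σ.truncate t).time ω = t := by
        simp only [time, truncate, min_eq_right (le_of_lt (show (t : ℕ∞) < σ.τ ω from hω)),
          ENat.toNat_natCast]
      have ha : (σ.truncate t).act ω = 1 := if_pos hω
      rw [Set.indicator_of_mem hω]
      simp [pathPayoff, stopBelief, ht, ha, expUtility, hu10]
    · have hle : σ.τ ω ≤ t := not_lt.1 hω
      have ht : (σ.truncate t).time ω = σ.time ω := by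
        simp only [time, truncate, min_eq_left hle]
      have ha : (σ.truncate t).act ω = σ.act ω := if_neg hω
      rw [Set.indicator_of_notMem hω]
      simp [pathPayoff, stopBelief, ht, ha]
  have hnonneg : 0 ≤ ∫ ω in E, (σ.pathPayoff u c ω - (belief μ₀ t ω * u 1 1 - c * t)) ∂I.law := by
    rw [← integral_indicator hEm]
    simp only [← hdiff]
    rw [integral_sub hpi hpi']
    exact sub_nonneg.2 hopt
  have hcost : ∫ ω, ((σ.time ω - t : ℕ) : ℝ) ∂I.law = ∫ ω in E, ((σ.time ω : ℝ) - t) ∂I.law := by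
    rw [← integral_indicator hEm]
    refine integral_congr_ae ?_
    filter_upwards [hEt] with ω hω
    by_cases h : ω ∈ E
    · rw [Set.indicator_of_mem h, Nat.cast_sub (hω.1 h).le]
    · rw [Set.indicator_of_notMem h, Nat.sub_eq_zero_of_le (not_lt.1 fun h' => h (hω.2 h'))]
      simp
  have hact : Integrable (fun ω => (if σ.act ω = 0 then (1 : ℝ) else 0)) I.law := by
    simpa using σ.integrable_action_mul (fun a => if a = 0 then 1 else 0) (integrable_const 1)
  have hzero : ∫ ω, (if t < σ.time ω ∧ σ.act ω = 0 then (1 : ℝ) else 0) ∂I.law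
      = ∫ ω in E, (if σ.act ω = 0 then (1 : ℝ) else 0) ∂I.law := by
    rw [← integral_indicator hEm]
    refine integral_congr_ae ?_
    filter_upwards [hEt] with ω hω
    by_cases h : ω ∈ E
    · simp [Set.indicator_of_mem h, hω.1 h]
    · rw [Set.indicator_of_notMem h, if_neg fun h' => h (hω.2 h'.1)]
  have htau := σ.setIntegral_stopBelief h0 h1 t
  have hle : ∫ ω in E, (σ.pathPayoff u c ω - (belief μ₀ t ω * u 1 1 - c * t)) ∂I.law
      ≤ ∫ ω in E, (u 0 0 * (if σ.act ω = 0 then (1 : ℝ) else 0)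
        + u 1 1 * (σ.stopBelief ω - belief μ₀ t ω) - c * ((σ.time ω : ℝ) - t)) ∂I.law := by
    refine integral_mono ?_ ?_ fun ω => ?_
    · exact (hpi.sub ((hmi.mul_const _).sub (integrable_const _))).integrableOn
    · exact (((hact.const_mul _).add ((hbi.sub hmi).const_mul _)).sub
        ((σ.integrable_time.sub (integrable_const _)).const_mul _)).integrableOn
    · have hb := σ.stopBelief_mem_Icc h0 h1 ω
      have h2 : σ.act ω = 0 ∨ σ.act ω = 1 := by
        generalize σ.act ω = a; fin_cases a <;> simp
      rcases h2 with h2 | h2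
      · simp only [pathPayoff, expUtility, h2, hu01, if_true]
        nlinarith [hb.1, mul_nonneg hb.1 hu00.le, mul_nonneg hb.1 hu11.le]
      · simp only [pathPayoff, expUtility, h2, hu10]
        norm_num
        nlinarith
  have hsum : ∫ ω in E, (u 0 0 * (if σ.act ω = 0 then (1 : ℝ) else 0)
        + u 1 1 * (σ.stopBelief ω - belief μ₀ t ω) - c * ((σ.time ω : ℝ) - t)) ∂I.law
      = u 0 0 * ∫ ω in E, (if σ.act ω = 0 then (1 : ℝ) else 0) ∂I.law
        - c * ∫ ω in E, ((σ.time ω : ℝ) - t) ∂I.law := by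
    rw [integral_sub, integral_add, integral_const_mul, integral_const_mul, integral_const_mul,
      integral_sub hbi.integrableOn hmi.integrableOn, htau, sub_self, mul_zero, add_zero]
    · exact (hact.const_mul _).integrableOn
    · exact ((hbi.sub hmi).const_mul _).integrableOn
    · exact ((hact.const_mul _).add ((hbi.sub hmi).const_mul _)).integrableOn
    · exact ((σ.integrable_time.sub (integrable_const _)).const_mul _).integrableOn
  rw [hcost, hzero]
  linarith

/-- The DM can stop at time `0`. -/
theorem IsResponse.stopUtility_le {u : Fin 2 → Fin 2 → ℝ} {c : ℝ} {σ : Strategy I}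
    (h : σ.IsResponse u c) : stopUtility u μ₀ ≤ σ.payoff u c := by
  have := I.isProb
  have hopt := h.optimal (bestReply I u (fun _ => 0) (fun i => by simp) 0 (by simp))
    fun ω => by simp
  refine le_trans (le_of_eq ?_) hopt
  simp [payoff, bestReply_pathPayoff, belief]

/-- A DM who waits at time `0` forgoes the payoff from stopping there. -/
theorem IsResponse.cost_add_le {u : Fin 2 → Fin 2 → ℝ} {c : ℝ} {σ : Strategy I}
    (h : σ.IsResponse u c) (h0 : 0 ≤ μ₀) (h1 : μ₀ ≤ 1) (hwait : ∀ ω, 0 < σ.τ ω)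
    (hu10 : u 1 0 = 0) (hu01 : u 0 1 = 0) (hu00 : 0 < u 0 0) (hu11 : 0 < u 1 1) :
    c * ∫ ω, (σ.time ω : ℝ) ∂I.law + stopUtility u μ₀ - μ₀ * u 1 1
        ≤ u 0 0 * ∫ ω, (if σ.act ω = 0 then (1 : ℝ) else 0) ∂I.law ∧
    c * ∫ ω, (σ.time ω : ℝ) ∂I.law + stopUtility u μ₀ - μ₀ * u 1 1 ≤ u 0 0 * (1 - μ₀) := by
  have := I.isProb
  have hbi := σ.integrable_stopBelief h0 h1
  have hact : Integrable (fun ω => (if σ.act ω = 0 then (1 : ℝ) else 0)) I.law := by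
    simpa using σ.integrable_action_mul (fun a => if a = 0 then 1 else 0) (integrable_const 1)
  have hmean : ∫ ω, σ.stopBelief ω ∂I.law = μ₀ := by
    have := σ.setIntegral_stopBelief h0 h1 0
    have huniv : {ω | ((0 : ℕ) : ℕ∞) < σ.τ ω} = Set.univ := Set.eq_univ_of_forall hwait
    rw [huniv, setIntegral_univ, setIntegral_univ] at this
    simpa [belief] using this
  have htau := h.stopUtility_le
  have hpay : σ.payoff u c - μ₀ * u 1 1 + c * ∫ ω, (σ.time ω : ℝ) ∂I.law
      = ∫ ω, (expUtility u (σ.act ω) (σ.stopBelief ω) - u 1 1 * σ.stopBelief ω) ∂I.law := by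
    have hexp : Integrable (fun ω => expUtility u (σ.act ω) (σ.stopBelief ω)) I.law := by
      refine ((σ.integrable_pathPayoff h0 h1 u c).add (σ.integrable_time.const_mul c)).congr
        (Filter.Eventually.of_forall fun ω => ?_)
      simp [pathPayoff]
    rw [payoff, integral_sub hexp (hbi.const_mul _), integral_const_mul, hmean]
    simp only [pathPayoff]
    rw [integral_sub hexp (σ.integrable_time.const_mul c), integral_const_mul]
    ring
  have hexp' : Integrable
      (fun ω => expUtility u (σ.act ω) (σ.stopBelief ω) - u 1 1 * σ.stopBelief ω) I.law := by
    refine (((σ.integrable_pathPayoff h0 h1 u c).add (σ.integrable_time.const_mul c)).sub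
      (hbi.const_mul (u 1 1))).congr (Filter.Eventually.of_forall fun ω => ?_)
    simp [pathPayoff]
  have hpt : ∀ ω, expUtility u (σ.act ω) (σ.stopBelief ω) - u 1 1 * σ.stopBelief ω
      ≤ u 0 0 * (if σ.act ω = 0 then (1 : ℝ) else 0) ∧
      expUtility u (σ.act ω) (σ.stopBelief ω) - u 1 1 * σ.stopBelief ω
      ≤ u 0 0 * (1 - σ.stopBelief ω) := by
    intro ω
    have hb := σ.stopBelief_mem_Icc h0 h1 ω
    have h2 : σ.act ω = 0 ∨ σ.act ω = 1 := by
      generalize σ.act ω = a; fin_cases a <;> simp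
    have h3 := mul_nonneg hu00.le (sub_nonneg.2 hb.2)
    have h4 := mul_nonneg hb.1 hu11.le
    have h5 := mul_nonneg hb.1 hu00.le
    rcases h2 with h2 | h2
    · simp only [expUtility, h2, hu01, if_true]
      constructor <;> linarith
    · simp only [expUtility, h2, hu10]
      norm_num
      constructor <;> linarith
  have hb1 := integral_mono hexp' (hact.const_mul (u 0 0)) fun ω => (hpt ω).1
  have hb2 := integral_mono hexp' (((integrable_const (1 : ℝ)).sub hbi).const_mul (u 0 0))
    fun ω => (hpt ω).2
  simp only [Pi.sub_apply] at hb2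
  rw [integral_const_mul] at hb1
  rw [integral_const_mul, integral_sub (integrable_const _) hbi, hmean, integral_const,
    probReal_univ, one_smul] at hb2
  constructor <;> linarith

end Strategy
/-- The highest probability with which the DM can still be waiting, or act on good news, after
time `1`. -/
noncomputable def survival (u : Fin 2 → Fin 2 → ℝ) (c μ₀ : ℝ) : ℝ :=
  min 1 (μ₀ / indiffBelief u) - c / u 0 0

theorem stopUtility_eq {u : Fin 2 → Fin 2 → ℝ} (hu10 : u 1 0 = 0) (hu01 : u 0 1 = 0)
    (hu00 : 0 < u 0 0) (hu11 : 0 < u 1 1) (μ : ℝ) :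
    stopUtility u μ = μ * u 1 1 + u 0 0 * (1 - min 1 (μ / indiffBelief u)) := by
  have h : μ / indiffBelief u * u 0 0 = μ * (u 0 0 + u 1 1) := by
    unfold indiffBelief; field_simp
  simp only [stopUtility, expUtility, hu10, hu01, mul_zero, add_zero, zero_add]
  rcases le_total 1 (μ / indiffBelief u) with h1 | h1
  · rw [min_eq_left h1, max_eq_right]
    · ring
    · nlinarith [mul_le_mul_of_nonneg_right h1 hu00.le]
  · rw [min_eq_right h1, max_eq_left]
    · linarith
    · nlinarith [mul_le_mul_of_nonneg_right h1 hu00.le]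

theorem firstBelief_eq {u : Fin 2 → Fin 2 → ℝ} (hu00 : 0 < u 0 0) (hu11 : 0 < u 1 1)
    (c μ₀ : ℝ) : firstBelief u c μ₀ = μ₀ / survival u c μ₀ := by
  have hpos : 0 < indiffBelief u := div_pos hu00 (by linarith)
  unfold firstBelief survival
  split_ifs with h
  · rw [min_eq_left ((one_le_div hpos).2 h)]
  · rw [min_eq_right ((div_le_one hpos).2 (not_le.1 h).le)]

namespace Strategy

variable {μ₀ : ℝ} {I : InfoStructure μ₀} (σ : Strategy I)

/-- The indicator of action `1`. -/
noncomputable def actsOneIndicator (a : Fin 2) : ℝ := if a = 1 then 1 else 0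

theorem integrable_comp_time {h : ℕ → ℝ} {C : ℝ} (hC : ∀ n, |h n| ≤ C) :
    Integrable (fun ω => h (σ.time ω)) I.law := by
  have := I.isProb
  exact integrable_of_bounded ((Measurable.of_discrete (f := h)).comp σ.measurable_time) C
    fun ω => hC _

theorem integrable_comp_time_of_le {h : ℕ → ℝ} {C D : ℝ} (hC : ∀ n, |h n| ≤ C + D * n) :
    Integrable (fun ω => h (σ.time ω)) I.law := by
  have := I.isProb
  refine ((integrable_const C).add (σ.integrable_time.const_mul D)).mono'
    ((Measurable.of_discrete (f := h)).comp σ.measurable_time).aestronglyMeasurable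
    (Filter.Eventually.of_forall fun ω => hC _)

/-- If the DM always optimally waits, then late good news must be geometrically unlikely. -/
theorem IsResponse.geometric_bound {u : Fin 2 → Fin 2 → ℝ} {c : ℝ} {σ : Strategy I}
    (h : σ.IsResponse u c) (h0 : 0 ≤ μ₀) (h1 : μ₀ ≤ 1) (hu10 : u 1 0 = 0) (hu01 : u 0 1 = 0)
    (hu00 : 0 < u 0 0) (hu11 : 0 < u 1 1) (hc : 0 < c) (hc' : c / u 0 0 < 1) (N : ℕ) :
    ∫ ω, actsOneIndicator (σ.act ω) * ((1 - c / u 0 0)⁻¹ ^ (min (σ.time ω) (N + 1) - 1) - 1) ∂I.law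
      + (1 - c / u 0 0)⁻¹ ^ N * (c / u 0 0) * ∫ ω, ((σ.time ω - (N + 1) : ℕ) : ℝ) ∂I.law
      ≤ c / u 0 0 * ∫ ω, ((σ.time ω - 1 : ℕ) : ℝ) ∂I.law := by
  have hcs : 0 < c / u 0 0 := div_pos hc hu00
  have hcost : ∀ t : ℕ, c / u 0 0 * ∫ ω, ((σ.time ω - t : ℕ) : ℝ) ∂I.law
      ≤ ∫ ω, (if t < σ.time ω ∧ σ.act ω = 0 then (1 : ℝ) else 0) ∂I.law := fun t => by
    have := h.cost_le h0 h1 hu10 hu01 hu00 hu11 t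
    rw [div_mul_eq_mul_div, div_le_iff₀ hu00]
    linarith
  set s := c / u 0 0 with hs
  set r := (1 - s)⁻¹ with hr
  have hr1 : r * (1 - s) = 1 := inv_mul_cancel₀ (by linarith)
  have hrpos : 0 < r := inv_pos.2 (by linarith)
  have hrge : 1 ≤ r := by nlinarith
  have hti : ∀ k : ℕ, Integrable (fun ω => ((σ.time ω - k : ℕ) : ℝ)) I.law := fun k =>
    σ.integrable_comp_time_of_le (h := fun n => ((n - k : ℕ) : ℝ)) (C := 0) (D := 1) fun n => by
      rw [abs_of_nonneg (Nat.cast_nonneg _), zero_add, one_mul]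
      exact Nat.cast_le.2 (Nat.sub_le _ _)
  have hHi : ∀ k : ℕ, Integrable
      (fun ω => actsOneIndicator (σ.act ω) * (r ^ (min (σ.time ω) (k + 1) - 1) - 1)) I.law :=
    fun k => σ.integrable_action_mul actsOneIndicator
      (σ.integrable_comp_time (h := fun n => r ^ (min n (k + 1) - 1) - 1) (C := r ^ k) fun n => by
        have h1 : r ^ (min n (k + 1) - 1) ≤ r ^ k := pow_le_pow_right₀ hrge (by omega)
        have h2 : 1 ≤ r ^ (min n (k + 1) - 1) := one_le_pow₀ hrge
        rw [abs_of_nonneg (by linarith)]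
        linarith)
  have hZi : ∀ k : ℕ, Integrable
      (fun ω => if k < σ.time ω ∧ σ.act ω = 0 then (1 : ℝ) else 0) I.law := fun k => by
    have := σ.integrable_action_mul (fun a => if a = 0 then 1 else 0)
      (σ.integrable_comp_time (h := fun n => if k < n then 1 else 0) (C := 1) fun n => by
        split_ifs <;> simp)
    refine this.congr (Filter.Eventually.of_forall fun ω => ?_)
    by_cases h1 : k < σ.time ω <;> by_cases h2 : σ.act ω = 0 <;> simp [h1, h2]
  induction N with
  | zero =>
    have : ∀ n : ℕ, min n (0 + 1) - 1 = 0 := fun n => by omega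
    simp [this]
  | succ N ih =>
    have hpt : ∀ ω, actsOneIndicator (σ.act ω) * (r ^ (min (σ.time ω) (N + 1 + 1) - 1) - 1)
        = actsOneIndicator (σ.act ω) * (r ^ (min (σ.time ω) (N + 1) - 1) - 1)
          + (r ^ (N + 1) - r ^ N) * (((σ.time ω - (N + 1) : ℕ) : ℝ)
            - ((σ.time ω - (N + 1 + 1) : ℕ) : ℝ)
            - if N + 1 < σ.time ω ∧ σ.act ω = 0 then (1 : ℝ) else 0) := by
      intro ω
      have h2 : σ.act ω = 0 ∨ σ.act ω = 1 := by
        generalize σ.act ω = a; fin_cases a <;> simp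
      rcases le_or_gt (σ.time ω) (N + 1) with ht | ht
      · rw [min_eq_left ht, min_eq_left (ht.trans (Nat.le_succ _)), Nat.sub_eq_zero_of_le ht,
          Nat.sub_eq_zero_of_le (ht.trans (Nat.le_succ _)), if_neg fun h => absurd h.1 ht.not_gt]
        simp
      · rw [min_eq_right ht.le, min_eq_right (Nat.succ_le_of_lt ht), Nat.cast_sub ht.le,
          Nat.cast_sub (Nat.succ_le_of_lt ht)]
        rcases h2 with h2 | h2
        · simp [h2, ht, actsOneIndicator]
        · simp [h2, actsOneIndicator]
    have hint : ∫ ω, actsOneIndicator (σ.act ω)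
          * (r ^ (min (σ.time ω) (N + 1 + 1) - 1) - 1) ∂I.law
        = ∫ ω, actsOneIndicator (σ.act ω) * (r ^ (min (σ.time ω) (N + 1) - 1) - 1) ∂I.law
          + (r ^ (N + 1) - r ^ N) * (∫ ω, ((σ.time ω - (N + 1) : ℕ) : ℝ) ∂I.law
            - ∫ ω, ((σ.time ω - (N + 1 + 1) : ℕ) : ℝ) ∂I.law
            - ∫ ω, (if N + 1 < σ.time ω ∧ σ.act ω = 0 then (1 : ℝ) else 0) ∂I.law) := by
      simp only [hpt]
      rw [integral_add, integral_const_mul, integral_sub, integral_sub]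
      exacts [hti _, hti _, (hti _).sub (hti _), hZi _, hHi N,
        (((hti _).sub (hti _)).sub (hZi _)).const_mul _]
    rw [hint]
    have hc1 := hcost (N + 1)
    generalize ∫ ω, ((σ.time ω - (N + 1) : ℕ) : ℝ) ∂I.law = a at *
    generalize ∫ ω, ((σ.time ω - (N + 1 + 1) : ℕ) : ℝ) ∂I.law = b at *
    generalize ∫ ω, (if N + 1 < σ.time ω ∧ σ.act ω = 0 then (1 : ℝ) else 0) ∂I.law = z at *
    have hrN : r ^ (N + 1) - r ^ N = r ^ (N + 1) * s := by
      have : r ^ N = r ^ (N + 1) * (1 - s) := by rw [pow_succ, mul_assoc, hr1, mul_one]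
      rw [this]; ring
    have hrN' : r ^ N * s * a = r ^ (N + 1) * s * ((1 - s) * a) := by
      have : r ^ N = r ^ (N + 1) * (1 - s) := by rw [pow_succ, mul_assoc, hr1, mul_one]
      rw [this]; ring
    have hkey : r ^ (N + 1) * s * (s * a) ≤ r ^ (N + 1) * s * z :=
      mul_le_mul_of_nonneg_left hc1 (by positivity)
    rw [hrN]
    linarith

/-- Bounds on the designer's payoff from obedience, one for each chord of the designer's gain
from action `1`. -/
theorem IsResponse.designerPayoff_le {u : Fin 2 → Fin 2 → ℝ} {c : ℝ} {σ : Strategy I}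
    (h : σ.IsResponse u c) (h0 : 0 ≤ μ₀) (h1 : μ₀ ≤ 1) (hwait : ∀ ω, 0 < σ.τ ω)
    (hu10 : u 1 0 = 0) (hu01 : u 0 1 = 0) (hu00 : 0 < u 0 0) (hu11 : 0 < u 1 1) (hc : 0 < c)
    (hc' : c / u 0 0 < 1) {f : Fin 2 → ℕ → ℝ} {g : ℕ → ℝ} {α β : ℝ}
    (hf0 : ∀ t : ℕ, f 0 t = α + β * t) (hf1 : ∀ t : ℕ, f 1 (t + 1) = α + β * (t + 1) + g t)
    (hg : ∀ t, 0 ≤ g t) (hmono : ∀ t, g t ≤ g (t + 1))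
    (hconc : ∀ t, g (t + 2) - g (t + 1) ≤ g (t + 1) - g t) :
    ∃ X, μ₀ ≤ X ∧ X ≤ survival u c μ₀ ∧ ∀ j : ℕ,
      σ.designerPayoff f
        ≤ α + β * ((min 1 (μ₀ / indiffBelief u) - X) / (c / u 0 0)) + g j * X
          + (g (j + 1) - g j) / ((1 - c / u 0 0)⁻¹ ^ (j + 1) - (1 - c / u 0 0)⁻¹ ^ j)
            * (survival u c μ₀ - (1 - c / u 0 0)⁻¹ ^ j * X) := by
  have := I.isProb
  have hgeo := h.geometric_bound h0 h1 hu10 hu01 hu00 hu11 hc hc'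
  obtain ⟨hS1, hS2⟩ := h.cost_add_le h0 h1 hwait hu10 hu01 hu00 hu11
  rw [stopUtility_eq hu10 hu01 hu00 hu11] at hS1 hS2
  unfold survival
  have hcu : c = c / u 0 0 * u 0 0 := by field_simp
  have hcs : 0 < c / u 0 0 := div_pos hc hu00
  set s := c / u 0 0 with hs
  set κ := min 1 (μ₀ / indiffBelief u) with hκ
  set r := (1 - s)⁻¹ with hr
  have hr1 : r * (1 - s) = 1 := inv_mul_cancel₀ (by linarith)
  have hrpos : 0 < r := inv_pos.2 (by linarith)
  have hrgt : 1 < r := by nlinarith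
  have hTpos : ∀ᵐ ω ∂I.law, 1 ≤ σ.time ω := by
    filter_upwards [σ.ae_finite] with ω hω
    have := hwait ω
    rw [hω] at this
    exact Nat.cast_pos.1 this
  set S := ∫ ω, (σ.time ω : ℝ) ∂I.law with hS
  set Z := ∫ ω, (if σ.act ω = 0 then (1 : ℝ) else 0) ∂I.law with hZ
  have hA : Integrable (fun ω => actsOneIndicator (σ.act ω)) I.law := by
    simpa using σ.integrable_action_mul actsOneIndicator (integrable_const 1)
  set P := ∫ ω, actsOneIndicator (σ.act ω) ∂I.law with hP
  have hPZ : P + Z = 1 := by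
    have hZi : Integrable (fun ω => (if σ.act ω = 0 then (1 : ℝ) else 0)) I.law := by
      simpa using σ.integrable_action_mul (fun a => if a = 0 then 1 else 0) (integrable_const 1)
    rw [hP, hZ, ← integral_add hA hZi]
    have : ∀ ω, actsOneIndicator (σ.act ω) + (if σ.act ω = 0 then (1 : ℝ) else 0) = 1 := by
      intro ω
      generalize σ.act ω = a
      fin_cases a <;> simp [actsOneIndicator]
    simp [this]
  have hSge : 1 ≤ S := one_le_integral_time hwait
  have hS' : ∫ ω, ((σ.time ω - 1 : ℕ) : ℝ) ∂I.law = S - 1 := by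
    have : ∫ ω, ((σ.time ω - 1 : ℕ) : ℝ) ∂I.law = ∫ ω, ((σ.time ω : ℝ) - 1) ∂I.law :=
      integral_congr_ae (hTpos.mono fun ω hω => by simp [Nat.cast_sub hω])
    rw [this, integral_sub σ.integrable_time (integrable_const _)]
    simp [hS]
  have hPX : P ≤ κ - s * S := by
    rw [hcu] at hS1
    have : u 0 0 * P ≤ u 0 0 * (κ - s * S) := by
      have : P = 1 - Z := by linarith
      rw [this]; nlinarith
    exact le_of_mul_le_mul_left this hu00
  have hXμ : μ₀ ≤ κ - s * S := by
    rw [hcu] at hS2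
    have : u 0 0 * μ₀ ≤ u 0 0 * (κ - s * S) := by nlinarith
    exact le_of_mul_le_mul_left this hu00
  refine ⟨κ - s * S, hXμ, by nlinarith, fun j => ?_⟩
  have hS'' : (κ - (κ - s * S)) / s = S := by field_simp; ring
  rw [hS'']
  set q := (g (j + 1) - g j) / (r ^ (j + 1) - r ^ j) with hq
  have hchord := le_geometric_chord hrgt hmono hconc j
  simp only [← hq] at hchord
  have hq0 : 0 ≤ q := by
    refine div_nonneg (by linarith [hmono j]) ?_
    have := pow_le_pow_right₀ hrgt.le (Nat.le_add_right j 1)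
    linarith
  have hgmono : Monotone g := monotone_nat_of_le_succ hmono
  have hglin : ∀ n, g n ≤ g 0 + (g 1 - g 0) * n := by
    intro n
    have hanti : Antitone fun t => g (t + 1) - g t := antitone_nat_of_succ_le fun t => hconc t
    induction n with
    | zero => simp
    | succ n ih =>
      have := hanti (Nat.zero_le n)
      simp only [zero_add] at this
      push_cast
      linarith
  have hgi : Integrable (fun ω => actsOneIndicator (σ.act ω) * g (σ.time ω - 1)) I.law :=
    σ.integrable_action_mul actsOneIndicator
      (σ.integrable_comp_time_of_le (h := fun n => g (n - 1)) (C := g 0) (D := g 1 - g 0)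
        fun n => by
          rw [abs_of_nonneg (hg _)]
          refine (hgmono (Nat.sub_le n 1)).trans (hglin n))
  have hA0 : ∀ a, 0 ≤ actsOneIndicator a := fun a => by
    unfold actsOneIndicator; split_ifs <;> norm_num
  have hbound : ∀ N : ℕ, ∫ ω, actsOneIndicator (σ.act ω) * g (min (σ.time ω) (N + 1) - 1) ∂I.law
      ≤ (g j + q * (1 - r ^ j)) * P + q * (s * (S - 1)) := by
    intro N
    have hHi : Integrable
        (fun ω => actsOneIndicator (σ.act ω) * (r ^ (min (σ.time ω) (N + 1) - 1) - 1)) I.law :=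
      σ.integrable_action_mul actsOneIndicator
        (σ.integrable_comp_time (h := fun n => r ^ (min n (N + 1) - 1) - 1) (C := r ^ N)
          fun n => by
            have h1 : r ^ (min n (N + 1) - 1) ≤ r ^ N := pow_le_pow_right₀ hrgt.le (by omega)
            have h2 : 1 ≤ r ^ (min n (N + 1) - 1) := one_le_pow₀ hrgt.le
            rw [abs_of_nonneg (by linarith)]
            linarith)
    have hgN : Integrable
        (fun ω => actsOneIndicator (σ.act ω) * g (min (σ.time ω) (N + 1) - 1)) I.law :=
      σ.integrable_action_mul actsOneIndicator
        (σ.integrable_comp_time (h := fun n => g (min n (N + 1) - 1)) (C := g N)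
          fun n => by
            rw [abs_of_nonneg (hg _)]
            exact hgmono (by omega))
    have hle := integral_mono hgN ((hA.const_mul (g j + q * (1 - r ^ j))).add (hHi.const_mul q))
      fun ω => by
        have := mul_le_mul_of_nonneg_left (hchord (min (σ.time ω) (N + 1) - 1)) (hA0 (σ.act ω))
        simp only [Pi.add_apply]
        linarith
    simp only [Pi.add_apply] at hle
    rw [integral_add (hA.const_mul _) (hHi.const_mul q), integral_const_mul,
      integral_const_mul] at hle
    refine hle.trans ?_
    have hgN' := hgeo N
    rw [hS'] at hgN'
    have hnn : 0 ≤ r ^ N * s * ∫ ω, ((σ.time ω - (N + 1) : ℕ) : ℝ) ∂I.law :=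
      mul_nonneg (by positivity) (integral_nonneg fun ω => Nat.cast_nonneg _)
    have := mul_le_mul_of_nonneg_left (a := q) (le_trans (le_add_of_nonneg_right hnn) hgN') hq0
    linarith
  have hlim : ∫ ω, actsOneIndicator (σ.act ω) * g (σ.time ω - 1) ∂I.law
      ≤ (g j + q * (1 - r ^ j)) * P + q * (s * (S - 1)) := by
    refine le_of_tendsto' (tendsto_integral_of_dominated_convergence
      (F := fun (N : ℕ) ω => actsOneIndicator (σ.act ω) * g (min (σ.time ω) (N + 1) - 1))
      (fun ω => actsOneIndicator (σ.act ω) * g (σ.time ω - 1)) (fun N => ?_) hgi (fun N => ?_) ?_)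
      hbound
    · exact (((measurable_of_finite actsOneIndicator).comp σ.measurable_action).mul
        ((Measurable.of_discrete (f := fun n => g (min n (N + 1) - 1))).comp
          σ.measurable_time)).aestronglyMeasurable
    · refine Filter.Eventually.of_forall fun ω => ?_
      rw [Real.norm_eq_abs, abs_of_nonneg (mul_nonneg (hA0 _) (hg _))]
      exact mul_le_mul_of_nonneg_left (hgmono (by omega)) (hA0 _)
    · refine Filter.Eventually.of_forall fun ω => tendsto_const_nhds.congr' ?_
      filter_upwards [Filter.eventually_ge_atTop (σ.time ω)] with N hN
      rw [min_eq_left (by omega)]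
  have hpay : σ.designerPayoff f = α + β * S
      + ∫ ω, actsOneIndicator (σ.act ω) * g (σ.time ω - 1) ∂I.law := by
    have : σ.designerPayoff f
        = ∫ ω, (α + β * σ.time ω + actsOneIndicator (σ.act ω) * g (σ.time ω - 1)) ∂I.law := by
      refine integral_congr_ae (hTpos.mono fun ω hω => ?_)
      obtain ⟨t, ht⟩ := Nat.exists_eq_add_of_le' hω
      have h2 : σ.act ω = 0 ∨ σ.act ω = 1 := by
        generalize σ.act ω = a; fin_cases a <;> simp
      rcases h2 with h2 | h2
      · simp [h2, ht, actsOneIndicator, hf0]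
      · simp [h2, ht, actsOneIndicator, hf1]
    rw [this, integral_add, integral_add, integral_const_mul]
    · simp [hS]
    · exact integrable_const _
    · exact σ.integrable_time.const_mul _
    · exact (integrable_const _).add (σ.integrable_time.const_mul _)
    · exact hgi
  rw [hpay]
  have hp0 : 0 ≤ g j + q * (1 - r ^ j) := by
    have := hchord 0
    rw [pow_zero] at this
    exact (hg 0).trans this
  have := mul_le_mul_of_nonneg_left hPX hp0
  linarith

end Strategy
/-! ### Structures with finitely many scenarios -/

/-- A finite family of scenarios: in scenario `i`, of probability `w i`, the belief follows the
common path `m` until time `N i`, when it moves to `φ i` and stays there. -/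
structure Scenarios (μ₀ : ℝ) (ι : Type) [Fintype ι] where
  N : ι → ℕ
  N_pos : ∀ i, 0 < N i
  w : ι → ℝ
  w_nonneg : ∀ i, 0 ≤ w i
  sum_w : ∑ i, w i = 1
  φ : ι → unitInterval
  m : ℕ → unitInterval
  m_zero : (m 0 : ℝ) = μ₀
  mean : ∀ t, ∑ i, (if t < N i then w i * (φ i : ℝ) else 0) = ∑ i, if t < N i then w i * m t else 0

namespace Scenarios

variable {μ₀ : ℝ} {ι : Type} [Fintype ι] (S : Scenarios μ₀ ι)

/-- The path in scenario `i`: the message is `0` before time `N i` and `1` from then on. -/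
noncomputable def path (i : ι) : Path := fun t =>
  if t + 1 < S.N i then (S.m (t + 1), 0) else (S.φ i, 1)

theorem belief_path (i : ι) (t : ℕ) :
    belief μ₀ t (S.path i) = if t < S.N i then (S.m t : ℝ) else S.φ i := by
  cases t with
  | zero => simp [belief, S.N_pos i, S.m_zero]
  | succ t =>
    simp only [belief, path]
    split_ifs <;> rfl

theorem path_agree {i j : ι} {t : ℕ} (hi : t < S.N i) (hj : t < S.N j) :
    ∀ k < t, S.path i k = S.path j k := fun k hk => by
  simp only [path]
  rw [if_pos (by omega), if_pos (by omega)]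

/-- The law of the path. -/
noncomputable def law : Measure Path := ∑ i, ENNReal.ofReal (S.w i) • Measure.dirac (S.path i)

theorem integral_law (F : Path → ℝ) : ∫ ω, F ω ∂S.law = ∑ i, S.w i * F (S.path i) := by
  unfold law
  rw [integral_finsetSum_measure]
  · refine Finset.sum_congr rfl fun i _ => ?_
    rw [integral_smul_measure, integral_dirac, ENNReal.toReal_ofReal (S.w_nonneg i), smul_eq_mul]
  · intro i _
    exact (integrable_dirac (by simp)).smul_measure ENNReal.ofReal_ne_top

theorem setIntegral_law {s : Set Path} (hs : MeasurableSet s) (F : Path → ℝ) :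
    ∫ ω in s, F ω ∂S.law = ∑ i, S.w i * s.indicator F (S.path i) := by
  rw [← integral_indicator hs, integral_law]

theorem ae_law_iff (P : Path → Prop) :
    (∀ᵐ ω ∂S.law, P ω) ↔ ∀ i, 0 < S.w i → P (S.path i) := by
  have h : S.law {ω | ¬ P ω} = ∑ i, ENNReal.ofReal (S.w i) * Measure.dirac (S.path i) {ω | ¬ P ω} := by
    simp [law]
  rw [ae_iff, h, Finset.sum_eq_zero_iff]
  refine forall_congr' fun i => ?_
  simp only [Finset.mem_univ, true_imp_iff, mul_eq_zero, ENNReal.ofReal_eq_zero,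
    Measure.dirac_apply]
  by_cases hP : P (S.path i)
  · simp [hP]
  · simp [hP]

instance : IsProbabilityMeasure S.law := ⟨by
  simp only [law, Measure.coe_finsetSum, Measure.coe_smul, Finset.sum_apply, Pi.smul_apply,
    measure_univ, smul_eq_mul, mul_one]
  rw [← ENNReal.ofReal_sum_of_nonneg fun i _ => S.w_nonneg i, S.sum_w, ENNReal.ofReal_one]⟩

theorem integrable_law (F : Path → ℝ) : Integrable F S.law := by
  unfold law
  exact integrable_finsetSum_measure.2 fun i _ =>
    (integrable_dirac (by simp)).smul_measure ENNReal.ofReal_ne_top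

theorem martingale_law : Martingale (belief μ₀) history S.law := by
  refine martingale_of_setIntegral_eq_succ
    (fun t => (measurable_belief_history μ₀ t).stronglyMeasurable)
    (fun t => S.integrable_law _) fun t s hs => ?_
  rw [S.setIntegral_law (history.le t _ hs), S.setIntegral_law (history.le t _ hs)]
  by_cases h : ∃ i, t < S.N i ∧ S.path i ∈ s
  · obtain ⟨i₀, hi₀, hs₀⟩ := h
    have hmem : ∀ i, t < S.N i → S.path i ∈ s := fun i hi =>
      (mem_iff_of_agree hs (S.path_agree hi₀ hi)).1 hs₀
    have hdiff : ∀ i, S.w i * s.indicator (belief μ₀ (t + 1)) (S.path i)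
        - S.w i * s.indicator (belief μ₀ t) (S.path i)
        = ((if t < S.N i then S.w i * (S.φ i : ℝ) else 0)
            - (if t < S.N i then S.w i * (S.m t : ℝ) else 0))
          - ((if t + 1 < S.N i then S.w i * (S.φ i : ℝ) else 0)
            - (if t + 1 < S.N i then S.w i * (S.m (t + 1) : ℝ) else 0)) := by
      intro i
      by_cases hi : t < S.N i
      · rw [Set.indicator_of_mem (hmem i hi), Set.indicator_of_mem (hmem i hi), S.belief_path,
          S.belief_path]
        by_cases hi' : t + 1 < S.N i
        · simp only [hi, hi', if_true]; ring
        · simp only [hi, hi', if_true, if_false]; ring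
      · have hi' : ¬ t + 1 < S.N i := by omega
        have : s.indicator (belief μ₀ (t + 1)) (S.path i)
            = s.indicator (belief μ₀ t) (S.path i) := by
          by_cases hm : S.path i ∈ s
          · rw [Set.indicator_of_mem hm, Set.indicator_of_mem hm, S.belief_path, S.belief_path,
              if_neg hi, if_neg hi']
          · rw [Set.indicator_of_notMem hm, Set.indicator_of_notMem hm]
        rw [this]
        simp [hi, hi']
    have hsum := Finset.sum_congr (rfl : (Finset.univ : Finset ι) = Finset.univ)
      fun i _ => hdiff i
    simp only [Finset.sum_sub_distrib] at hsum
    linarith [S.mean t, S.mean (t + 1)]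
  · refine Finset.sum_congr rfl fun i _ => ?_
    by_cases hm : S.path i ∈ s
    · have hi : ¬ t < S.N i := fun hi => h ⟨i, hi, hm⟩
      rw [Set.indicator_of_mem hm, Set.indicator_of_mem hm, S.belief_path, S.belief_path,
        if_neg hi, if_neg (by omega)]
    · rw [Set.indicator_of_notMem hm, Set.indicator_of_notMem hm]

/-- The information structure given by the scenarios. -/
noncomputable def info : InfoStructure μ₀ where
  law := S.law
  isProb := inferInstance
  martingale := S.martingale_law

/-! ### The problem of the DM -/

/-- The first time from `n` on at which the DM receives a stop message, or at which all scenarios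
have ended. -/
noncomputable def stopTime (n : ℕ) (ω : Path) : ℕ := by
  classical
  exact Nat.find (p := fun t => n ≤ t ∧ (Finset.univ.sup S.N ≤ t ∨ 1 ≤ t ∧ (ω (t - 1)).2 = 1))
    ⟨max n (Finset.univ.sup S.N), le_max_left _ _, Or.inl (le_max_right _ _)⟩

theorem measurableSet_stopTime_le (n i : ℕ) :
    MeasurableSet[history i] {ω | S.stopTime n ω ≤ i} := by
  have : {ω | S.stopTime n ω ≤ i} = ⋃ t ∈ Set.Iic i,
      {ω | n ≤ t ∧ (Finset.univ.sup S.N ≤ t ∨ 1 ≤ t ∧ (ω (t - 1)).2 = 1)} := by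
    ext ω
    simp only [stopTime, Set.mem_ofPred_eq, Nat.find_le_iff, Set.mem_iUnion, Set.mem_Iic,
      exists_prop]
  rw [this]
  refine MeasurableSet.biUnion (Set.to_countable _) fun t ht => history.mono ht _ ?_
  have hmsg : MeasurableSet[history t] {ω : Path | 1 ≤ t ∧ (ω (t - 1)).2 = 1} := by
    cases t with
    | zero => simp
    | succ t =>
      refine ⟨{x | (x (Fin.last t)).2 = 1}, ?_, ?_⟩
      · exact (measurable_snd.comp (measurable_pi_apply (Fin.last t))) (measurableSet_singleton 1)
      · ext ω
        simp
  exact (@MeasurableSet.const _ (history t) _).inter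
    ((@MeasurableSet.const _ (history t) _).union hmsg)

theorem stopTime_le (n : ℕ) (ω : Path) : S.stopTime n ω ≤ max n (Finset.univ.sup S.N) := by
  classical
  exact Nat.find_min' _ ⟨le_max_left _ _, Or.inl (le_max_right _ _)⟩

theorem le_stopTime (n : ℕ) (ω : Path) : n ≤ S.stopTime n ω := by
  classical
  unfold stopTime
  exact (Nat.find_spec (p := fun t =>
    n ≤ t ∧ (Finset.univ.sup S.N ≤ t ∨ 1 ≤ t ∧ (ω (t - 1)).2 = 1)) _).1

theorem stopTime_path (n : ℕ) (i : ι) : S.stopTime n (S.path i) = max n (S.N i) := by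
  classical
  have hsup : S.N i ≤ Finset.univ.sup S.N := Finset.le_sup (Finset.mem_univ i)
  have hN := S.N_pos i
  unfold stopTime
  rw [Nat.find_eq_iff]
  refine ⟨⟨le_max_left _ _, Or.inr ⟨le_max_of_le_right hN, ?_⟩⟩, fun t ht => ?_⟩
  · have : ¬ (max n (S.N i) - 1 + 1 < S.N i) := by omega
    simp [path, this]
  · rintro ⟨h1, h2 | ⟨h2, h3⟩⟩
    · omega
    · have : t - 1 + 1 < S.N i := by
        rw [Nat.sub_add_cancel h2]
        exact (lt_max_iff.1 ht).resolve_left h1.not_gt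
      simp [path, this] at h3

/-- Wait until time `n`, then stop at the first stop message. -/
noncomputable def obey (u : Fin 2 → Fin 2 → ℝ) (n : ℕ) : Strategy S.info :=
  bestReply S.info u (S.stopTime n) (S.measurableSet_stopTime_le n) _ (S.stopTime_le n)

theorem obey_τ (u : Fin 2 → Fin 2 → ℝ) (n : ℕ) (ω : Path) :
    (S.obey u n).τ ω = (S.stopTime n ω : ℕ∞) := rfl

theorem obey_pathPayoff (u : Fin 2 → Fin 2 → ℝ) (c : ℝ) (n : ℕ) (i : ι) :
    (S.obey u n).pathPayoff u c (S.path i)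
      = stopUtility u (S.φ i) - c * (max n (S.N i) : ℕ) := by
  unfold obey
  rw [Strategy.bestReply_pathPayoff, S.stopTime_path, S.belief_path,
    if_neg (le_max_right _ _).not_gt]

theorem obey_payoff (u : Fin 2 → Fin 2 → ℝ) (c : ℝ) (n : ℕ) :
    (S.obey u n).payoff u c
      = ∑ i, S.w i * (stopUtility u (S.φ i) - c * (max n (S.N i) : ℕ)) := by
  unfold Strategy.payoff
  refine (S.integral_law _).trans ?_
  simp only [obey_pathPayoff]

theorem pathPayoff_le {u : Fin 2 → Fin 2 → ℝ} {c : ℝ} {I : InfoStructure μ₀} (σ : Strategy I)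
    (ω : Path) : σ.pathPayoff u c ω ≤ stopUtility u (belief μ₀ (σ.time ω) ω) - c * σ.time ω := by
  unfold Strategy.pathPayoff Strategy.stopBelief stopUtility
  have : ∀ (a : Fin 2) μ, expUtility u a μ ≤ max (expUtility u 0 μ) (expUtility u 1 μ) := by
    intro a μ
    fin_cases a
    · exact le_max_left _ _
    · exact le_max_right _ _
  linarith [this (σ.act ω) (belief μ₀ (σ.time ω) ω)]

/-- At every time `t ≥ n` the DM weakly prefers obedience to stopping at a continue message. -/
def Persuasive (u : Fin 2 → Fin 2 → ℝ) (c : ℝ) (n : ℕ) : Prop :=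
  ∀ t, n ≤ t → ∑ i, (if t < S.N i then S.w i * (stopUtility u (S.m t) - c * t) else 0)
    ≤ ∑ i, if t < S.N i then S.w i * (stopUtility u (S.φ i) - c * S.N i) else 0

variable {S}

theorem Persuasive.payoff_add_le {u : Fin 2 → Fin 2 → ℝ} {c : ℝ} {n : ℕ}
    (h : S.Persuasive u c n) (σ : Strategy S.info)
    (hσ : ∀ ω, (n : ℕ∞) ≤ σ.τ ω) :
    σ.payoff u c + c * ∑ i, S.w i * ((σ.time (S.path i) - max n (S.N i) : ℕ) : ℝ)
      ≤ ∑ i, S.w i * (stopUtility u (S.φ i) - c * (max n (S.N i) : ℕ)) := by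
  have hfin : ∀ i, 0 < S.w i → σ.τ (S.path i) = (σ.time (S.path i) : ℕ∞) :=
    (S.ae_law_iff _).1 σ.ae_finite
  have hn : ∀ i, 0 < S.w i → n ≤ σ.time (S.path i) := fun i hi => by
    have := hσ (S.path i)
    rw [hfin i hi] at this
    exact Nat.cast_le.1 this
  have hsame : ∀ i j, 0 < S.w i → 0 < S.w j → σ.time (S.path i) < S.N i →
      σ.time (S.path i) < S.N j → σ.time (S.path j) = σ.time (S.path i) := by
    intro i j hi hj h1 h2
    have := (mem_iff_of_agree (σ.isStopping.measurableSet_eq (σ.time (S.path i)))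
      (S.path_agree h1 h2)).1 (hfin i hi)
    have h3 : σ.τ (S.path j) = (σ.time (S.path i) : ℕ∞) := this
    rw [hfin j hj] at h3
    exact Nat.cast_inj.1 h3
  have hpay : σ.payoff u c = ∑ i, S.w i * σ.pathPayoff u c (S.path i) := S.integral_law _
  rw [hpay, Finset.mul_sum, ← Finset.sum_add_distrib]
  have hlate : ∀ i, (0 < S.w i → S.N i ≤ σ.time (S.path i)) →
      S.w i * σ.pathPayoff u c (S.path i)
        + c * (S.w i * ((σ.time (S.path i) - max n (S.N i) : ℕ) : ℝ))
      ≤ S.w i * (stopUtility u (S.φ i) - c * (max n (S.N i) : ℕ)) := by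
    intro i hi
    rcases (S.w_nonneg i).eq_or_lt with h0 | h0
    · simp [← h0]
    · have h1 := pathPayoff_le (u := u) (c := c) σ (S.path i)
      rw [S.belief_path, if_neg (hi h0).not_gt] at h1
      rw [Nat.cast_sub (max_le (hn i h0) (hi h0))]
      have := mul_le_mul_of_nonneg_left h1 h0.le
      linarith
  by_cases hearly : ∃ i, 0 < S.w i ∧ σ.time (S.path i) < S.N i
  · obtain ⟨i₀, hw₀, hi₀⟩ := hearly
    have hmt := h (σ.time (S.path i₀)) (hn i₀ hw₀)
    have hterm : ∀ i, S.w i * σ.pathPayoff u c (S.path i)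
          + c * (S.w i * ((σ.time (S.path i) - max n (S.N i) : ℕ) : ℝ))
        ≤ S.w i * (stopUtility u (S.φ i) - c * (max n (S.N i) : ℕ))
          + ((if σ.time (S.path i₀) < S.N i then
              S.w i * (stopUtility u (S.m (σ.time (S.path i₀))) - c * σ.time (S.path i₀)) else 0)
            - if σ.time (S.path i₀) < S.N i then
              S.w i * (stopUtility u (S.φ i) - c * S.N i) else 0) := by
      intro i
      by_cases hi : σ.time (S.path i₀) < S.N i
      · rw [if_pos hi, if_pos hi]
        rcases (S.w_nonneg i).eq_or_lt with h0 | h0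
        · simp [← h0]
        · have h1 := pathPayoff_le (u := u) (c := c) σ (S.path i)
          have h2 := hsame i₀ i hw₀ h0 hi₀ hi
          have h3 : n ≤ S.N i := (hn i₀ hw₀).trans hi.le
          rw [h2, S.belief_path, if_pos hi] at h1
          rw [h2, max_eq_right h3, Nat.sub_eq_zero_of_le hi.le]
          have := mul_le_mul_of_nonneg_left h1 h0.le
          simp only [Nat.cast_zero, mul_zero]
          linarith
      · rw [if_neg hi, if_neg hi, sub_zero, add_zero]
        refine hlate i fun h0 => ?_
        by_contra hlt
        push Not at hlt
        have := hsame i i₀ h0 hw₀ hlt (by omega)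
        omega
    refine (Finset.sum_le_sum fun i _ => hterm i).trans ?_
    rw [Finset.sum_add_distrib, Finset.sum_sub_distrib]
    linarith
  · push Not at hearly
    exact Finset.sum_le_sum fun i _ => hlate i (hearly i)

theorem Persuasive.isResponseFrom {u : Fin 2 → Fin 2 → ℝ} {c : ℝ} {n : ℕ}
    (h : S.Persuasive u c n) (hc : 0 < c) : (S.obey u n).IsResponseFrom u c n where
  start ω := by
    rw [obey_τ]
    exact Nat.cast_le.2 (S.le_stopTime n ω)
  optimal σ' hσ' := by
    rw [S.obey_payoff]
    refine le_trans (le_add_of_nonneg_right ?_) (h.payoff_add_le σ' hσ')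
    exact mul_nonneg hc.le (Finset.sum_nonneg fun i _ =>
      mul_nonneg (S.w_nonneg i) (Nat.cast_nonneg _))
  waits σ' hσ' heq := by
    have hle := h.payoff_add_le σ' hσ'
    rw [heq, S.obey_payoff] at hle
    have hsum : ∑ i, S.w i * ((σ'.time (S.path i) - max n (S.N i) : ℕ) : ℝ) ≤ 0 := by
      by_contra hpos
      push Not at hpos
      linarith [mul_pos hc hpos]
    have hz := (Finset.sum_eq_zero_iff_of_nonneg fun i _ =>
      mul_nonneg (S.w_nonneg i) (Nat.cast_nonneg _)).1 (le_antisymm hsum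
        (Finset.sum_nonneg fun i _ => mul_nonneg (S.w_nonneg i) (Nat.cast_nonneg _)))
    refine (S.ae_law_iff _).2 fun i hi => ?_
    have hfin := (S.ae_law_iff _).1 σ'.ae_finite i hi
    rw [obey_τ, S.stopTime_path, hfin]
    have := (mul_eq_zero.1 (hz i (Finset.mem_univ i))).resolve_left hi.ne'
    exact Nat.cast_le.2 (Nat.sub_eq_zero_iff_le.1 (Nat.cast_eq_zero.1 this))
  actsOne := by
    refine Filter.Eventually.of_forall fun ω hω => ?_
    unfold obey at hω ⊢
    rw [Strategy.bestReply_act]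
    unfold Strategy.stopBelief at hω
    rw [Strategy.bestReply_time] at hω
    exact if_pos hω

theorem Persuasive.mono {u : Fin 2 → Fin 2 → ℝ} {c : ℝ} {n n' : ℕ}
    (h : S.Persuasive u c n) (hn : n ≤ n') : S.Persuasive u c n' :=
  fun t ht => h t (hn.trans ht)

theorem Persuasive.isExtremalObedient {u : Fin 2 → Fin 2 → ℝ} {c : ℝ}
    (h : S.Persuasive u c 1) (hc : 0 < c)
    (hφ : ∀ i, (S.φ i : ℝ) ∈ ({0, indiffBelief u, 1} : Set ℝ)) :
    IsExtremalObedient u c S.info where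
  extremal := by
    refine ⟨fun t => S.m t, (S.ae_law_iff _).2 fun i _ t => ?_⟩
    rw [S.belief_path]
    by_cases ht : t + 1 < S.N i
    · right
      simp [path, ht]
    · left
      rw [if_neg ht]
      exact ⟨by simp [path, ht], hφ i⟩
  obedient t := by
    refine ⟨S.obey u (t + 1), (h.mono (by omega)).isResponseFrom hc,
      (S.ae_law_iff _).2 fun i _ => ?_⟩
    rw [obey_τ, S.stopTime_path]
    by_cases ht : t + 1 < S.N i
    · refine ⟨fun hm => by simp [path, ht] at hm, fun _ => ?_⟩
      rw [max_eq_right ht.le]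
      exact Nat.cast_lt.2 ht
    · refine ⟨fun _ => ?_, fun hm => by simp [path, ht] at hm⟩
      rw [max_eq_left (not_lt.1 ht)]

end Scenarios
/-! ### Bad news structures -/

/-- `X t` can be the probability that no bad news has arrived by time `t`, when all those who
have not seen bad news by time `T` then stop at a belief of at least `μ̄`. -/
structure IsSurvival (u : Fin 2 → Fin 2 → ℝ) (μ₀ : ℝ) (T : ℕ) (X : ℕ → ℝ) : Prop where
  pos : 0 < T
  zero : X 0 = 1
  anti : ∀ t < T, X (t + 1) ≤ X t
  prior_pos : 0 < μ₀
  prior_le : μ₀ ≤ X T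
  le_prior : X T ≤ μ₀ / indiffBelief u
  u_zero_pos : 0 < u 0 0
  u_one_pos : 0 < u 1 1

theorem sum_Ico_telescope {a b : ℕ → ℝ} {t T : ℕ} (htT : t ≤ T)
    (h : ∀ i, t ≤ i → i < T → a i = b (i + 1) - b i) :
    ∑ i ∈ Finset.Ico t T, a i = b T - b t := by
  induction T, htT using Nat.le_induction with
  | base => simp
  | succ T hT ih =>
    rw [Finset.sum_Ico_succ_top hT, ih fun i h1 h2 => h i h1 (h2.trans T.lt_succ_self),
      h T hT T.lt_succ_self]
    ring

namespace IsSurvival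

variable {u : Fin 2 → Fin 2 → ℝ} {μ₀ : ℝ} {T : ℕ} {X : ℕ → ℝ}

theorem le_of_le (h : IsSurvival u μ₀ T X) {t : ℕ} (ht : t ≤ T) : X T ≤ X t := by
  induction ht using Nat.decreasingInduction with
  | self => exact le_rfl
  | of_succ t ht ih => exact ih.trans (h.anti t ht)

theorem indiffBelief_pos (h : IsSurvival u μ₀ T X) : 0 < indiffBelief u :=
  div_pos h.u_zero_pos (add_pos h.u_zero_pos h.u_one_pos)

theorem indiffBelief_lt_one (h : IsSurvival u μ₀ T X) : indiffBelief u < 1 := by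
  have := h.u_zero_pos
  have := h.u_one_pos
  rw [indiffBelief, div_lt_one (by linarith)]
  linarith

theorem X_pos (h : IsSurvival u μ₀ T X) {t : ℕ} (ht : t ≤ T) : 0 < X t :=
  h.prior_pos.trans_le (h.prior_le.trans (h.le_of_le ht))

/-- The scenarios are bad news at time `t + 1 ≤ T`, and stopping at time `T` with belief `1`
or `μ̄`. -/
noncomputable def scenarios (h : IsSurvival u μ₀ T X) : Scenarios μ₀ (Fin T ⊕ Bool) where
  N := Sum.elim (fun i => i + 1) fun _ => T
  N_pos := by
    rintro (i | b)
    · exact Nat.succ_pos _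
    · exact h.pos
  w := Sum.elim (fun i => X i - X (i + 1)) fun b =>
    if b then (μ₀ - indiffBelief u * X T) / (1 - indiffBelief u)
    else (X T - μ₀) / (1 - indiffBelief u)
  w_nonneg := by
    have h1 := h.indiffBelief_lt_one
    rintro (i | b | b)
    · exact sub_nonneg.2 (h.anti i i.2)
    · exact div_nonneg (sub_nonneg.2 h.prior_le) (by linarith)
    · refine div_nonneg (sub_nonneg.2 ?_) (by linarith)
      have := (le_div_iff₀ h.indiffBelief_pos).1 h.le_prior
      linarith
  sum_w := by
    have h1 : 1 - indiffBelief u ≠ 0 := by linarith [h.indiffBelief_lt_one]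
    rw [Fintype.sum_sum_type, Fintype.sum_bool]
    simp only [Sum.elim_inl, Sum.elim_inr, if_true]
    rw [Fin.sum_univ_eq_sum_range (fun i => X i - X (i + 1)) T, Finset.sum_range_sub', h.zero]
    simp only [Bool.false_eq_true, if_false]
    field_simp
    ring
  φ := Sum.elim (fun _ => 0) fun b =>
    if b then 1 else ⟨indiffBelief u, h.indiffBelief_pos.le, h.indiffBelief_lt_one.le⟩
  m t := Set.projIcc 0 1 zero_le_one (μ₀ / X t)
  m_zero := by
    have h0 := h.prior_le.trans (h.le_of_le h.pos.le)
    rw [h.zero] at h0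
    rw [h.zero, div_one, Set.projIcc_of_mem zero_le_one ⟨h.prior_pos.le, h0⟩]
  mean t := by
    have h1 : 1 - indiffBelief u ≠ 0 := by linarith [h.indiffBelief_lt_one]
    rw [Fintype.sum_sum_type, Fintype.sum_bool, Fintype.sum_sum_type, Fintype.sum_bool]
    rcases lt_or_ge t T with ht | ht
    · have hX := h.X_pos ht.le
      have hmem : μ₀ / X t ∈ Set.Icc (0 : ℝ) 1 :=
        ⟨div_nonneg h.prior_pos.le hX.le,
          (div_le_one hX).2 (h.prior_le.trans (h.le_of_le ht.le))⟩
      rw [Set.projIcc_of_mem zero_le_one hmem]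
      have hs : ∑ i : Fin T, (if t < (i : ℕ) + 1 then (X i - X (i + 1)) * (μ₀ / X t) else 0)
          = (X t - X T) * (μ₀ / X t) := by
        rw [Fin.sum_univ_eq_sum_range
          (fun i => if t < i + 1 then (X i - X (i + 1)) * (μ₀ / X t) else 0) T,
          ← Finset.sum_filter,
          show (Finset.range T).filter (fun i => t < i + 1) = Finset.Ico t T by
            ext i; simp; omega,
          sum_Ico_telescope (b := fun i => - X i * (μ₀ / X t)) ht.le fun i _ _ => by ring]
        ring
      change (∑ i : Fin T, if t < (i : ℕ) + 1 then (X i - X (i + 1)) * ((0 : unitInterval) : ℝ)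
          else 0) + _ = (∑ i : Fin T, if t < (i : ℕ) + 1 then (X i - X (i + 1)) * (μ₀ / X t)
          else 0) + _
      rw [hs]
      simp [ht]
      field_simp
      ring
    · have : ∀ i : Fin T, ¬ t < (i : ℕ) + 1 := fun i => by omega
      simp [this, ht.not_gt]

theorem sum_scenarios (h : IsSurvival u μ₀ T X) {t : ℕ} (ht : t < T) (F : Fin T ⊕ Bool → ℝ)
    (G : ℕ → ℝ) (hG : ∀ i, F (Sum.inl i) = G i) :
    ∑ i, (if t < h.scenarios.N i then h.scenarios.w i * F i else 0)
      = ∑ i ∈ Finset.Ico t T, (X i - X (i + 1)) * G i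
        + ((μ₀ - indiffBelief u * X T) / (1 - indiffBelief u) * F (Sum.inr true)
          + (X T - μ₀) / (1 - indiffBelief u) * F (Sum.inr false)) := by
  rw [Fintype.sum_sum_type, Fintype.sum_bool]
  simp only [scenarios, Sum.elim_inl, Sum.elim_inr, if_true, ht, hG]
  rw [Fin.sum_univ_eq_sum_range
    (fun i => if t < i + 1 then (X i - X (i + 1)) * G i else 0) T, ← Finset.sum_filter,
    show (Finset.range T).filter (fun i => t < i + 1) = Finset.Ico t T by ext i; simp; omega]
  simp

theorem sum_scenarios_of_le (h : IsSurvival u μ₀ T X) {t : ℕ} (ht : T ≤ t)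
    (F : Fin T ⊕ Bool → ℝ) :
    ∑ i, (if t < h.scenarios.N i then h.scenarios.w i * F i else 0) = 0 := by
  refine Finset.sum_eq_zero fun i _ => if_neg ?_
  rcases i with i | b
  · have := i.2
    simp only [scenarios, Sum.elim_inl]
    omega
  · simpa [scenarios] using ht

theorem sum_const (h : IsSurvival u μ₀ T X) {t : ℕ} (ht : t < T) (y : ℝ) :
    ∑ i, (if t < h.scenarios.N i then h.scenarios.w i * y else 0) = X t * y := by
  have h1 : 1 - indiffBelief u ≠ 0 := by linarith [h.indiffBelief_lt_one]
  rw [h.sum_scenarios ht (fun _ => y) (fun _ => y) fun _ => rfl,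
    sum_Ico_telescope (b := fun i => - X i * y) ht.le fun i _ _ => by ring]
  field_simp
  ring

theorem stopUtility_zero (h : IsSurvival u μ₀ T X) (hu10 : u 1 0 = 0) (hu01 : u 0 1 = 0) :
    stopUtility u 0 = u 0 0 := by
  rw [stopUtility_eq hu10 hu01 h.u_zero_pos h.u_one_pos]
  simp

theorem stopUtility_of_le (h : IsSurvival u μ₀ T X) (hu10 : u 1 0 = 0) (hu01 : u 0 1 = 0) {μ : ℝ}
    (hμ : indiffBelief u ≤ μ) : stopUtility u μ = μ * u 1 1 := by
  rw [stopUtility_eq hu10 hu01 h.u_zero_pos h.u_one_pos,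
    min_eq_left ((one_le_div h.indiffBelief_pos).2 hμ)]
  simp

/-- The value of obeying from time `t` on. -/
theorem sum_value (h : IsSurvival u μ₀ T X) (hu10 : u 1 0 = 0) (hu01 : u 0 1 = 0) (c : ℝ)
    {t : ℕ} (ht : t < T) :
    ∑ i, (if t < h.scenarios.N i then
        h.scenarios.w i * (stopUtility u (h.scenarios.φ i) - c * h.scenarios.N i) else 0)
      = ∑ i ∈ Finset.Ico t T, (X i - X (i + 1)) * (u 0 0 - c * (i + 1))
        + (μ₀ * u 1 1 - c * T * X T) := by
  have h1 : 1 - indiffBelief u ≠ 0 := by linarith [h.indiffBelief_lt_one]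
  rw [h.sum_scenarios ht
    (fun i => stopUtility u (h.scenarios.φ i) - c * h.scenarios.N i)
    (fun i => u 0 0 - c * (i + 1)) fun i => ?_]
  · have e1 : stopUtility u (h.scenarios.φ (Sum.inr true)) = u 1 1 := by
      rw [h.stopUtility_of_le hu10 hu01] <;> simp [scenarios, h.indiffBelief_lt_one.le]
    have e2 : stopUtility u (h.scenarios.φ (Sum.inr false)) = indiffBelief u * u 1 1 := by
      rw [h.stopUtility_of_le hu10 hu01] <;> simp [scenarios]
    have e3 : ∀ b, h.scenarios.N (Sum.inr b) = T := fun _ => rfl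
    rw [e1, e2, e3, e3]
    field_simp
    ring
  · simp [scenarios, h.stopUtility_zero hu10 hu01]

theorem coe_m (h : IsSurvival u μ₀ T X) {t : ℕ} (ht : t ≤ T) :
    (h.scenarios.m t : ℝ) = μ₀ / X t := by
  have hX := h.X_pos ht
  have hmem : μ₀ / X t ∈ Set.Icc (0 : ℝ) 1 :=
    ⟨div_nonneg h.prior_pos.le hX.le, (div_le_one hX).2 (h.prior_le.trans (h.le_of_le ht))⟩
  simp only [scenarios]
  rw [Set.projIcc_of_mem zero_le_one hmem]

theorem φ_mem (h : IsSurvival u μ₀ T X) (i : Fin T ⊕ Bool) :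
    (h.scenarios.φ i : ℝ) ∈ ({0, indiffBelief u, 1} : Set ℝ) := by
  rcases i with i | b | b <;> simp [scenarios]

theorem persuasive_iff (h : IsSurvival u μ₀ T X) (hu10 : u 1 0 = 0) (hu01 : u 0 1 = 0) {c : ℝ}
    {n : ℕ} : h.scenarios.Persuasive u c n ↔ ∀ t, n ≤ t → t < T →
      X t * (stopUtility u (μ₀ / X t) - c * t)
        ≤ ∑ i ∈ Finset.Ico t T, (X i - X (i + 1)) * (u 0 0 - c * (i + 1))
          + (μ₀ * u 1 1 - c * T * X T) := by
  refine forall_congr' fun t => imp_congr_right fun _ => ?_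
  rcases lt_or_ge t T with ht | ht
  · rw [h.sum_value hu10 hu01 c ht, h.coe_m ht.le, h.sum_const ht]
    simp [ht]
  · rw [h.sum_scenarios_of_le ht, h.sum_scenarios_of_le ht]
    simp [ht.not_gt]

theorem designerPayoff_obey (h : IsSurvival u μ₀ T X) (hu10 : u 1 0 = 0) (hu01 : u 0 1 = 0)
    (f : Fin 2 → ℕ → ℝ) :
    (h.scenarios.obey u 0).designerPayoff f
      = ∑ i ∈ Finset.Ico 0 T, (X i - X (i + 1)) * f 0 (i + 1) + X T * f 1 T := by
  have h1 : 1 - indiffBelief u ≠ 0 := by linarith [h.indiffBelief_lt_one]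
  have hu0 := h.u_zero_pos
  have hu1 := h.u_one_pos
  have hsum := h.sum_scenarios h.pos
    (fun i => f (if expUtility u 0 (h.scenarios.φ i) ≤ expUtility u 1 (h.scenarios.φ i)
      then 1 else 0) (h.scenarios.N i)) (fun i => f 0 (i + 1)) fun i => by
        simp [scenarios, expUtility, hu10, hu0.not_ge]
  have hpay : (h.scenarios.obey u 0).designerPayoff f
      = ∑ i, (if 0 < h.scenarios.N i then h.scenarios.w i * f (if expUtility u 0 (h.scenarios.φ i)
        ≤ expUtility u 1 (h.scenarios.φ i) then 1 else 0) (h.scenarios.N i) else 0) := by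
    unfold Strategy.designerPayoff Scenarios.obey
    refine (h.scenarios.integral_law _).trans (Finset.sum_congr rfl fun i _ => ?_)
    rw [if_pos (h.scenarios.N_pos i), Strategy.bestReply_time, Strategy.bestReply_act,
      h.scenarios.stopTime_path, h.scenarios.belief_path, Nat.zero_max, if_neg (lt_irrefl _)]
  rw [hpay, hsum]
  have e1 : expUtility u 0 (h.scenarios.φ (Sum.inr true))
      ≤ expUtility u 1 (h.scenarios.φ (Sum.inr true)) := by
    simp [scenarios, expUtility, hu01, hu1.le]
  have e2 : expUtility u 0 (h.scenarios.φ (Sum.inr false))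
      ≤ expUtility u 1 (h.scenarios.φ (Sum.inr false)) := by
    simp only [scenarios, expUtility, hu01, hu10, Sum.elim_inr, indiffBelief]
    simp
    field_simp
    simp
  have e3 : ∀ b, h.scenarios.N (Sum.inr b) = T := fun _ => rfl
  rw [if_pos e1, if_pos e2, e3, e3]
  field_simp
  ring

end IsSurvival
theorem Scenarios.real_law {μ₀ : ℝ} {ι : Type} [Fintype ι] (S : Scenarios μ₀ ι) (s : Set Path) :
    S.law.real s = ∑ i, S.w i * s.indicator (fun _ => (1 : ℝ)) (S.path i) := by
  have h : S.law s = ∑ i, ENNReal.ofReal (S.w i) * Measure.dirac (S.path i) s := by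
    simp [Scenarios.law]
  rw [Measure.real, h, ENNReal.toReal_sum fun i _ =>
    ENNReal.mul_ne_top ENNReal.ofReal_ne_top (measure_ne_top _ _)]
  refine Finset.sum_congr rfl fun i _ => ?_
  rw [ENNReal.toReal_mul, ENNReal.toReal_ofReal (S.w_nonneg i), Measure.dirac_apply]
  by_cases hi : S.path i ∈ s <;> simp [hi]

theorem survival_le {u : Fin 2 → Fin 2 → ℝ} {c μ₀ : ℝ} (hc : 0 < c) (hu00 : 0 < u 0 0) :
    survival u c μ₀ ≤ 1 ∧ survival u c μ₀ ≤ μ₀ / indiffBelief u := by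
  have := div_pos hc hu00
  unfold survival
  exact ⟨by linarith [min_le_left 1 (μ₀ / indiffBelief u)],
    by linarith [min_le_right 1 (μ₀ / indiffBelief u)]⟩

/-- Survival probabilities when the DM is made indifferent at each time by bad news only. -/
noncomputable def geometricSurvival (u : Fin 2 → Fin 2 → ℝ) (c μ₀ : ℝ) : ℕ → ℝ
  | 0 => 1
  | t + 1 => survival u c μ₀ * (1 - c / u 0 0) ^ t

section Geometric

variable {u : Fin 2 → Fin 2 → ℝ} {c μ₀ : ℝ}

theorem isSurvival_geometric (hu00 : 0 < u 0 0) (hu11 : 0 < u 1 1) (hc : 0 < c)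
    (hc' : c / u 0 0 < 1) (hμ₀ : 0 < μ₀) {j : ℕ} (hj : μ₀ ≤ geometricSurvival u c μ₀ (j + 1)) :
    IsSurvival u μ₀ (j + 1) (geometricSurvival u c μ₀) := by
  have hs := div_pos hc hu00
  have hsurv := survival_le (μ₀ := μ₀) hc hu00
  have hpos : 0 < survival u c μ₀ := by
    have hp := pow_pos (sub_pos.2 hc') j
    simp only [geometricSurvival] at hj
    exact pos_of_mul_pos_left (hμ₀.trans_le hj) hp.le
  refine ⟨j.succ_pos, rfl, fun t _ => ?_, hμ₀, hj, ?_, hu00, hu11⟩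
  · cases t with
    | zero => simpa [geometricSurvival] using hsurv.1
    | succ t =>
      simp only [geometricSurvival]
      exact mul_le_mul_of_nonneg_left
        (pow_le_pow_of_le_one (by linarith) (by linarith) (Nat.le_succ t)) hpos.le
  · refine le_trans ?_ hsurv.2
    exact mul_le_of_le_one_right hpos.le (pow_le_one₀ (by linarith) (by linarith))

theorem geometricSurvival_succ {t : ℕ} (ht : 1 ≤ t) :
    geometricSurvival u c μ₀ (t + 1) = geometricSurvival u c μ₀ t * (1 - c / u 0 0) := by
  obtain ⟨t, rfl⟩ := Nat.exists_eq_add_of_le' ht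
  simp only [geometricSurvival, pow_succ, mul_assoc]

/-- The DM is indifferent at all times. -/
theorem geometric_value (hu10 : u 1 0 = 0) (hu01 : u 0 1 = 0) {T : ℕ}
    (h : IsSurvival u μ₀ T (geometricSurvival u c μ₀)) (hc : 0 < c)
    {t : ℕ} (ht : t < T) :
    geometricSurvival u c μ₀ t * (stopUtility u (μ₀ / geometricSurvival u c μ₀ t) - c * t)
      = ∑ i ∈ Finset.Ico t T, (geometricSurvival u c μ₀ i - geometricSurvival u c μ₀ (i + 1))
          * (u 0 0 - c * (i + 1)) + (μ₀ * u 1 1 - c * T * geometricSurvival u c μ₀ T) := by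
  have hu := h.u_zero_pos
  set X := geometricSurvival u c μ₀ with hX
  have hsum : ∀ t, 1 ≤ t → t ≤ T → ∑ i ∈ Finset.Ico t T, (X i - X (i + 1)) * (u 0 0 - c * (i + 1))
      = c * T * X T - c * t * X t := by
    intro t h1 h2
    refine sum_Ico_telescope (b := fun i => c * i * X i) h2 fun i hi _ => ?_
    have : X (i + 1) = X i * (1 - c / u 0 0) := geometricSurvival_succ (h1.trans hi)
    rw [this]
    push_cast
    field_simp
    ring
  rcases Nat.eq_zero_or_pos t with rfl | h1
  · rw [Finset.sum_eq_sum_Ico_succ_bot ht, hsum 1 le_rfl ht]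
    have hX1 : X 1 = min 1 (μ₀ / indiffBelief u) - c / u 0 0 := by
      simp [hX, geometricSurvival, survival]
    rw [zero_add, hX1, h.zero, div_one, stopUtility_eq hu10 hu01 hu h.u_one_pos]
    push_cast
    field_simp
    ring
  · have hXt := h.X_pos ht.le
    have hle : X t ≤ μ₀ / indiffBelief u := by
      obtain ⟨t, rfl⟩ := Nat.exists_eq_add_of_le' h1
      refine le_trans ?_ (survival_le hc hu).2
      have hs := div_pos hc hu
      have : ∀ k, k + 1 ≤ T → X (k + 1) ≤ X 1 := by
        intro k hk
        induction k with
        | zero => exact le_rfl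
        | succ k ih => exact (h.anti (k + 1) hk).trans (ih (by omega))
      refine (this t ht.le).trans (le_of_eq ?_)
      simp [hX, geometricSurvival]
    rw [hsum t h1 ht.le, h.stopUtility_of_le hu10 hu01]
    · field_simp
      ring
    · rw [le_div_iff₀ hXt]
      have := (le_div_iff₀ h.indiffBelief_pos).1 hle
      linarith

theorem isAlmostGeometric_geometric (hu10 : u 1 0 = 0) (hu01 : u 0 1 = 0) {T : ℕ}
    (h : IsSurvival u μ₀ T (geometricSurvival u c μ₀)) (hc : 0 < c) :
    (h.scenarios.obey u 0).IsResponse u c ∧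
      IsAlmostGeometric u c (h.scenarios.obey u 0) T := by
  have hpers : h.scenarios.Persuasive u c 0 :=
    (h.persuasive_iff hu10 hu01).2 fun t _ ht => (geometric_value hu10 hu01 h hc ht).le
  have hN : ∀ i, h.scenarios.N i ≤ T := by
    rintro (i | b)
    · exact i.2
    · exact le_rfl
  have hτ : ∀ i, (h.scenarios.obey u 0).τ (h.scenarios.path i) = (h.scenarios.N i : ℕ∞) :=
    fun i => by rw [Scenarios.obey_τ, h.scenarios.stopTime_path, Nat.zero_max]
  have htime : ∀ i, (h.scenarios.obey u 0).time (h.scenarios.path i) = h.scenarios.N i :=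
    fun i => by rw [Strategy.time, hτ, ENat.toNat_natCast]
  refine ⟨hpers.isResponseFrom hc, ⟨(hpers.mono (Nat.zero_le 1)).isExtremalObedient hc h.φ_mem,
    (h.scenarios.ae_law_iff _).2 fun i _ => ?_, (h.scenarios.ae_law_iff _).2 fun i _ _ => ?_,
    fun t ht => (h.scenarios.ae_law_iff _).2 fun i _ hi => ?_, fun t h1 ht => ?_, fun t ht => ?_⟩⟩
  · rw [hτ]
    exact Nat.cast_le.2 (hN i)
  · rw [Strategy.stopBelief, htime, h.scenarios.belief_path, if_neg (lt_irrefl _)]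
    exact h.φ_mem i
  · rw [hτ] at hi
    have hi : h.scenarios.N i = t := Nat.cast_inj.1 hi
    rw [h.scenarios.belief_path, if_neg (by omega)]
    rcases i with i | b
    · simp [IsSurvival.scenarios]
    · exact absurd hi ht.ne'
  · have hden : h.scenarios.info.law.real {ω | (t : ℕ∞) < (h.scenarios.obey u 0).τ ω}
        = geometricSurvival u c μ₀ t := by
      refine (h.scenarios.real_law _).trans ?_
      have := h.sum_const (t := t) (by omega) 1
      rw [mul_one] at this
      rw [← this]
      refine Finset.sum_congr rfl fun i _ => ?_
      by_cases hi : t < h.scenarios.N i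
      · have : h.scenarios.path i ∈ {ω | (t : ℕ∞) < (h.scenarios.obey u 0).τ ω} := by
          rw [Set.mem_ofPred_eq, hτ]
          exact Nat.cast_lt.2 hi
        rw [if_pos hi, Set.indicator_of_mem this]
      · have : h.scenarios.path i ∉ {ω | (t : ℕ∞) < (h.scenarios.obey u 0).τ ω} := by
          rw [Set.mem_ofPred_eq, hτ]
          exact fun h' => hi (Nat.cast_lt.1 h')
        rw [if_neg hi, Set.indicator_of_notMem this, mul_zero]
    have hnum : h.scenarios.info.law.real
        {ω | (h.scenarios.obey u 0).τ ω = (t + 1 : ℕ) ∧ belief μ₀ (t + 1) ω = 0}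
        = geometricSurvival u c μ₀ t - geometricSurvival u c μ₀ (t + 1) := by
      refine (h.scenarios.real_law _).trans ?_
      rw [Finset.sum_eq_single (Sum.inl ⟨t, by omega⟩)]
      · rw [Set.indicator_of_mem]
        · simp [IsSurvival.scenarios]
        · rw [Set.mem_ofPred_eq, hτ, h.scenarios.belief_path]
          simp [IsSurvival.scenarios]
      · intro i _ hi
        rw [Set.indicator_of_notMem, mul_zero]
        rw [Set.mem_ofPred_eq, hτ]
        rintro ⟨h', -⟩
        have h' : h.scenarios.N i = t + 1 := Nat.cast_inj.1 h'
        rcases i with i | b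
        · refine hi ?_
          simp only [IsSurvival.scenarios, Sum.elim_inl] at h'
          congr 1
          exact Fin.ext (by simpa using h')
        · simp only [IsSurvival.scenarios, Sum.elim_inr] at h'
          omega
      · simp
    have hX := h.X_pos (t := t) (by omega)
    rw [hden, hnum, geometricSurvival_succ h1]
    field_simp
    ring
  · have hms : MeasurableSet {ω | (t : ℕ∞) < (h.scenarios.obey u 0).τ ω} :=
      history.le t _ ((h.scenarios.obey u 0).measurableSet_lt t)
    refine (h.scenarios.setIntegral_law hms _).trans
      (Eq.trans ?_ (h.scenarios.setIntegral_law hms _).symm)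
    have hind : ∀ (F : Path → ℝ) i, h.scenarios.w i
        * {ω | (t : ℕ∞) < (h.scenarios.obey u 0).τ ω}.indicator F (h.scenarios.path i)
        = if t < h.scenarios.N i then h.scenarios.w i * F (h.scenarios.path i) else 0 := by
      intro F i
      by_cases hi : t < h.scenarios.N i
      · have : h.scenarios.path i ∈ {ω | (t : ℕ∞) < (h.scenarios.obey u 0).τ ω} := by
          rw [Set.mem_ofPred_eq, hτ]
          exact Nat.cast_lt.2 hi
        rw [if_pos hi, Set.indicator_of_mem this]
      · have : h.scenarios.path i ∉ {ω | (t : ℕ∞) < (h.scenarios.obey u 0).τ ω} := by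
          rw [Set.mem_ofPred_eq, hτ]
          exact fun h' => hi (Nat.cast_lt.1 h')
        rw [if_neg hi, Set.indicator_of_notMem this, mul_zero]
    simp only [hind, Scenarios.obey_pathPayoff, Nat.zero_max]
    rw [h.sum_value hu10 hu01 c ht, ← geometric_value hu10 hu01 h hc ht, ← h.sum_const ht]
    refine Finset.sum_congr rfl fun i _ => ?_
    by_cases hi : t < h.scenarios.N i
    · rw [if_pos hi, if_pos hi, h.scenarios.belief_path, if_pos hi, h.coe_m ht.le]
    · rw [if_neg hi, if_neg hi]

theorem designerPayoff_geometric (hu10 : u 1 0 = 0) (hu01 : u 0 1 = 0) (hc : 0 < c) {j : ℕ}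
    (h : IsSurvival u μ₀ (j + 1) (geometricSurvival u c μ₀)) {f : Fin 2 → ℕ → ℝ} {g : ℕ → ℝ}
    {α β : ℝ} (hf0 : ∀ t : ℕ, f 0 t = α + β * t)
    (hf1 : ∀ t : ℕ, f 1 (t + 1) = α + β * (t + 1) + g t) :
    (h.scenarios.obey u 0).designerPayoff f
      = α + β * ((min 1 (μ₀ / indiffBelief u) - geometricSurvival u c μ₀ (j + 1)) / (c / u 0 0))
        + g j * geometricSurvival u c μ₀ (j + 1) := by
  have hu := h.u_zero_pos
  have hX1 : geometricSurvival u c μ₀ 1 = min 1 (μ₀ / indiffBelief u) - c / u 0 0 := by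
    simp [geometricSurvival, survival]
  rw [h.designerPayoff_obey hu10 hu01, Finset.sum_eq_sum_Ico_succ_bot j.succ_pos, zero_add,
    sum_Ico_telescope (b := fun i => - geometricSurvival u c μ₀ i * (α + β * i + β / (c / u 0 0)))
      (Nat.succ_le_succ j.zero_le), hf1, hf0, hX1, h.zero]
  · push_cast
    field_simp
    ring
  · intro i hi _
    rw [geometricSurvival_succ hi, hf0]
    push_cast
    field_simp
    ring

end Geometric

/-! ### Stopping at time `0` -/

/-- A structure under which the DM stops at time `0`: full information comes so late that it is
just not worth waiting for. -/
theorem exists_stopping_structure {u : Fin 2 → Fin 2 → ℝ} {c μ₀ : ℝ} (hu10 : u 1 0 = 0)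
    (hu01 : u 0 1 = 0) (hu00 : 0 < u 0 0) (hu11 : 0 < u 1 1) (hc : 0 < c) (hμ₀ : 0 < μ₀)
    (hμ₀' : μ₀ < 1) :
    ∃ (I : InfoStructure μ₀) (σ : Strategy I), σ.IsResponse u c ∧ IsAlmostGeometric u c σ 0 ∧
      ∀ ω, σ.τ ω = 0 := by
  set G := (1 - μ₀) * u 0 0 + μ₀ * u 1 1 - stopUtility u μ₀ with hG
  have hG0 : 0 ≤ G := by
    simp only [hG, stopUtility, expUtility, hu10, hu01, mul_zero, zero_add, add_zero]
    have h1 := mul_nonneg (sub_nonneg.2 hμ₀'.le) hu00.le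
    have h2 := mul_nonneg hμ₀.le hu11.le
    linarith [max_le (a := (1 - μ₀) * u 0 0) (b := μ₀ * u 1 1)
      (c := (1 - μ₀) * u 0 0 + μ₀ * u 1 1) (by linarith) (by linarith)]
  set T := ⌊G / c⌋₊ + 1 with hT
  have hT1 : c * ((T : ℝ) - 1) ≤ G := by
    have := Nat.floor_le (div_nonneg hG0 hc.le)
    rw [le_div_iff₀ hc] at this
    rw [hT]
    push_cast
    linarith
  have hT2 : G < c * T := by
    have := Nat.lt_floor_add_one (G / c)
    rw [div_lt_iff₀ hc] at this
    rw [hT]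
    push_cast
    linarith
  have hpos : 0 < indiffBelief u := div_pos hu00 (add_pos hu00 hu11)
  have hlt : indiffBelief u < 1 := by
    rw [indiffBelief, div_lt_one (by linarith)]
    linarith
  have hS : IsSurvival u μ₀ T (fun t => if t < T then 1 else μ₀) := by
    refine ⟨Nat.succ_pos _, if_pos (Nat.succ_pos _), fun t ht => ?_, hμ₀, by simp, ?_, hu00, hu11⟩
    · rw [if_pos ht]
      split_ifs
      exacts [le_rfl, hμ₀'.le]
    · simp only [lt_irrefl, if_false]
      rw [le_div_iff₀ hpos]
      nlinarith
  have hval : ∀ t < T, ∑ i ∈ Finset.Ico t T, ((if i < T then 1 else μ₀)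
      - (if i + 1 < T then 1 else μ₀)) * (u 0 0 - c * (i + 1))
      + (μ₀ * u 1 1 - c * T * (if T < T then 1 else μ₀)) = G + stopUtility u μ₀ - c * T := by
    intro t ht
    rw [sum_Ico_telescope (b := fun i => - (if i < T then 1 else μ₀) * (u 0 0 - c * T)) ht.le]
    · simp only [lt_irrefl, if_false, ht, if_true]
      rw [hG]
      ring
    · intro i _ hi
      by_cases hi' : i + 1 < T
      · simp [hi, hi']
      · have : (T : ℝ) = i + 1 := by exact_mod_cast (by omega : T = i + 1)
        simp only [hi, hi', if_true, if_false, this]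
        ring
  have hpers : hS.scenarios.Persuasive u c 1 := by
    rw [hS.persuasive_iff hu10 hu01]
    intro t h1 ht
    rw [hval t ht, if_pos ht, div_one, one_mul]
    have : c ≤ c * t := le_mul_of_one_le_right hc.le (by exact_mod_cast h1)
    linarith
  set I := hS.scenarios.info with hI
  have : IsProbabilityMeasure I.law := I.isProb
  let σ : Strategy I := bestReply I u (fun _ => 0) (fun i => by simp) 0 (by simp)
  have hτ : ∀ ω, σ.τ ω = 0 := fun ω => rfl
  have hσ : σ.payoff u c = stopUtility u μ₀ := by
    simp [σ, Strategy.payoff, Strategy.bestReply_pathPayoff, belief]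
  have hwait : ∀ σ' : Strategy I, (∀ ω, 0 < σ'.τ ω) → σ'.payoff u c < stopUtility u μ₀ := by
    intro σ' hσ'
    have h1 := hpers.payoff_add_le σ' fun ω => by
      push_cast
      exact Order.one_le_iff_pos.2 (hσ' ω)
    have h2 : ∑ i, hS.scenarios.w i
        * (stopUtility u (hS.scenarios.φ i) - c * (max 1 (hS.scenarios.N i) : ℕ))
        = G + stopUtility u μ₀ - c * T := by
      rw [← hval 0 hS.pos, ← hS.sum_value hu10 hu01 c hS.pos]
      refine Finset.sum_congr rfl fun i _ => ?_
      rw [if_pos (hS.scenarios.N_pos i), max_eq_right (hS.scenarios.N_pos i)]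
    have h3 : 0 ≤ c * ∑ i, hS.scenarios.w i
        * ((σ'.time (hS.scenarios.path i) - max 1 (hS.scenarios.N i) : ℕ) : ℝ) :=
      mul_nonneg hc.le (Finset.sum_nonneg fun i _ =>
        mul_nonneg (hS.scenarios.w_nonneg i) (Nat.cast_nonneg _))
    linarith
  refine ⟨I, σ, ⟨fun ω => by simp, fun σ' _ => ?_, fun σ' _ heq => ?_, ?_⟩,
    ⟨hpers.isExtremalObedient hc hS.φ_mem, Filter.Eventually.of_forall fun ω => by simp [hτ],
      Filter.Eventually.of_forall fun ω hω => absurd hω (by simp [hτ]), fun t ht => by omega,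
      fun t _ ht => by omega, fun t ht => by omega⟩, hτ⟩
  · rw [hσ]
    rcases σ'.stops_or_waits with h | h
    · have : ∀ ω, σ'.pathPayoff u c ω ≤ stopUtility u μ₀ := fun ω => by
        have := Scenarios.pathPayoff_le (u := u) (c := c) σ' ω
        have ht : σ'.time ω = 0 := by simp [Strategy.time, h ω]
        rw [ht] at this
        simpa [belief] using this
      have hle := integral_mono (σ'.integrable_pathPayoff hμ₀.le hμ₀'.le u c)
        (integrable_const (μ := I.law) _) this
      simpa [Strategy.payoff] using hle
    · exact (hwait σ' h).le
  · rcases σ'.stops_or_waits with h | h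
    · exact Filter.Eventually.of_forall fun ω => by simp [h ω]
    · exact absurd heq (by rw [hσ]; exact (hwait σ' h).ne)
  · refine Filter.Eventually.of_forall fun ω hω => ?_
    exact if_pos hω

/-- The integer condition says that the geometric survival probabilities hit the prior. -/
theorem IntegerCondition.exists_eq {u : Fin 2 → Fin 2 → ℝ} {c μ₀ : ℝ}
    (h : IntegerCondition u c μ₀) (hu00 : 0 < u 0 0) (hu11 : 0 < u 1 1) (hc : 0 < c)
    (hc' : c / u 0 0 < 1) (hμ₀ : 0 < μ₀) (hle : μ₀ ≤ survival u c μ₀) :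
    ∃ k : ℕ, μ₀ = survival u c μ₀ * (1 - c / u 0 0) ^ k := by
  obtain ⟨n, hn⟩ := h
  rw [firstBelief_eq hu00 hu11] at hn
  have hs := div_pos hc hu00
  have hρ : 0 < 1 - c / u 0 0 := by linarith
  have hpos : 0 < survival u c μ₀ := hμ₀.trans_le hle
  have hq : 0 < μ₀ / survival u c μ₀ := div_pos hμ₀ hpos
  have hlog : Real.log (1 - c / u 0 0) < 0 := Real.log_neg hρ (by linarith)
  have hlog' : Real.log (μ₀ / survival u c μ₀) ≤ 0 :=
    Real.log_nonpos hq.le ((div_le_one hpos).2 hle)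
  have hn0 : 0 ≤ n := by
    have : (0 : ℝ) ≤ n := hn ▸ div_nonneg_of_nonpos hlog' hlog.le
    exact_mod_cast this
  obtain ⟨k, rfl⟩ := Int.eq_ofNat_of_zero_le hn0
  refine ⟨k, ?_⟩
  rw [div_eq_iff hlog.ne, Int.cast_natCast, ← Real.log_pow] at hn
  have := Real.log_injOn_pos hq (pow_pos hρ k) hn
  rw [← this]
  field_simp

/-- If the DM can be made to wait at time `0`, then an almost-geometric bad news structure is
optimal among the structures under which she waits at time `0`. -/
theorem exists_optimal_waiting {u : Fin 2 → Fin 2 → ℝ} {c μ₀ : ℝ} {f : Fin 2 → ℕ → ℝ}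
    (hu10 : u 1 0 = 0) (hu01 : u 0 1 = 0) (hu00 : 0 < u 0 0) (hu11 : 0 < u 1 1)
    (hc : 0 < c) (hμ₀ : 0 < μ₀) (hμ₀' : μ₀ < 1)
    (hf : ∀ t, f 0 t ≤ f 1 t)
    (hsuper : ∀ s t, s ≤ t → f 1 s + f 0 t ≤ f 1 t + f 0 s)
    (hconcave : ∀ t, f 1 (t + 2) - f 1 (t + 1) ≤ f 1 (t + 1) - f 1 t)
    (haffine : ∃ α β : ℝ, ∀ t : ℕ, f 0 t = α + β * t)
    (hint : IntegerCondition u c μ₀)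
    {I₀ : InfoStructure μ₀} {σ₀ : Strategy I₀} (hσ₀ : σ₀.IsResponse u c)
    (hwait₀ : ∀ ω, 0 < σ₀.τ ω) :
    ∃ (I : InfoStructure μ₀) (σ : Strategy I) (T : ℕ),
      1 ≤ T ∧ σ.IsResponse u c ∧ IsAlmostGeometric u c σ T ∧
      ∀ (I' : InfoStructure μ₀) (σ' : Strategy I'),
        σ'.IsResponse u c → (∀ ω, 0 < σ'.τ ω) → σ'.designerPayoff f ≤ σ.designerPayoff f := by
  obtain ⟨α, β, hf0⟩ := haffine
  set g : ℕ → ℝ := fun t => f 1 (t + 1) - f 0 (t + 1) with hgdef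
  have hg : ∀ t, 0 ≤ g t := fun t => sub_nonneg.2 (hf _)
  have hmono : ∀ t, g t ≤ g (t + 1) := fun t => by
    have := hsuper (t + 1) (t + 1 + 1) (Nat.le_succ _)
    simp only [hgdef]
    linarith
  have hconc : ∀ t, g (t + 2) - g (t + 1) ≤ g (t + 1) - g t := fun t => by
    have := hconcave (t + 1)
    simp only [hgdef, hf0]
    push_cast
    have e : t + 1 + 2 = t + 2 + 1 := rfl
    rw [e] at this
    linarith
  have hf1 : ∀ t : ℕ, f 1 (t + 1) = α + β * (t + 1) + g t := fun t => by
    simp only [hgdef, hf0]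
    push_cast
    ring
  have hs := div_pos hc hu00
  have hc' : c / u 0 0 < 1 := by
    have h1 := (hσ₀.cost_add_le hμ₀.le hμ₀'.le hwait₀ hu10 hu01 hu00 hu11).2
    have h2 := mul_le_mul_of_nonneg_left (Strategy.one_le_integral_time hwait₀) hc.le
    have h3 : μ₀ * u 1 1 ≤ stopUtility u μ₀ := by
      simp [stopUtility, expUtility, hu10]
    rw [div_lt_one hu00]
    nlinarith [mul_pos hu00 hμ₀]
  have hbound := fun (I' : InfoStructure μ₀) (σ' : Strategy I') (h' : σ'.IsResponse u c)
    (hw : ∀ ω, 0 < σ'.τ ω) => h'.designerPayoff_le hμ₀.le hμ₀'.le hw hu10 hu01 hu00 hu11 hc hc'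
      hf0 hf1 hg hmono hconc
  obtain ⟨X₀, hX₀, hX₀', -⟩ := hbound I₀ σ₀ hσ₀ hwait₀
  have hsurv := hX₀.trans hX₀'
  obtain ⟨k, hk⟩ := hint.exists_eq hu00 hu11 hc hc' hμ₀ hsurv
  let x : ℕ → ℝ := fun j => geometricSurvival u c μ₀ (j + 1)
  have hx : ∀ j, x j = survival u c μ₀ * (1 - c / u 0 0) ^ j := fun j => rfl
  have hxk : x k = μ₀ := by rw [hx, ← hk]
  have hxanti : ∀ j ≤ k, μ₀ ≤ x j := fun j hj => by
    rw [← hxk, hx, hx]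
    exact mul_le_mul_of_nonneg_left (pow_le_pow_of_le_one (by linarith) (by linarith) hj)
      (hμ₀.le.trans hsurv)
  let J : ℕ → ℝ := fun j =>
    α + β * ((min 1 (μ₀ / indiffBelief u) - x j) / (c / u 0 0)) + g j * x j
  obtain ⟨j, hj, hmax⟩ := Finset.exists_max_image (Finset.range (k + 1)) J ⟨0, by simp⟩
  have hjk : j ≤ k := Nat.lt_succ_iff.1 (Finset.mem_range.1 hj)
  have hS := isSurvival_geometric hu00 hu11 hc hc' hμ₀ (hxanti j hjk)
  obtain ⟨hresp, hgeo⟩ := isAlmostGeometric_geometric hu10 hu01 hS hc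
  refine ⟨_, _, j + 1, Nat.succ_pos j, hresp, hgeo, fun I' σ' h' hw => ?_⟩
  rw [designerPayoff_geometric hu10 hu01 hc hS hf0 hf1]
  obtain ⟨X, hX, hX', hle⟩ := hbound I' σ' h' hw
  set s := c / u 0 0 with hsdef
  set κ := min 1 (μ₀ / indiffBelief u) with hκ
  set r := (1 - s)⁻¹ with hr
  have hr1 : r * (1 - s) = 1 := inv_mul_cancel₀ (by linarith)
  have hrgt : 1 < r := by
    have : 0 < r := inv_pos.2 (by linarith)
    nlinarith
  have hrx : ∀ i, r ^ i * x i = survival u c μ₀ := fun i => by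
    rw [hx, mul_left_comm, ← mul_pow, hr1, one_pow, mul_one]
  let q : ℕ → ℝ := fun i => (g (i + 1) - g i) / (r ^ (i + 1) - r ^ i)
  have hq : ∀ i, q i * (r ^ (i + 1) - r ^ i) = g (i + 1) - g i := fun i => by
    refine div_mul_cancel₀ _ (sub_ne_zero.2 ?_)
    exact (pow_lt_pow_right₀ hrgt (Nat.lt_succ_self i)).ne'
  obtain ⟨i, hi, hvi⟩ := exists_le_of_interpolation (J := J) (x := x) (y := X) (n := k)
    (v := σ'.designerPayoff f) (hxk ▸ hX) (by rw [hx, pow_zero, mul_one]; exact hX')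
    (fun i => α + β * (κ / s) + q i * survival u c μ₀)
    (fun i => g i - q i * r ^ i - β / s)
    (fun i => (hle i).trans (le_of_eq (by
      change _ + q i * _ = _
      ring)))
    (fun i => by
      simp only [J]
      rw [← hrx i]
      ring)
    (fun i => by
      have h1 : q i * r ^ (i + 1) = g (i + 1) - g i + q i * r ^ i := by linarith [hq i]
      have h2 : q i * survival u c μ₀ = (g (i + 1) - g i + q i * r ^ i) * x (i + 1) := by
        rw [← h1, ← hrx (i + 1)]; ring
      simp only [J]
      rw [h2]
      ring)
  exact hvi.trans (hmax i (Finset.mem_range.2 (Nat.lt_succ_of_le hi)))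

/-- The designer's payoff if the DM stops at time `0`. -/
theorem Strategy.IsResponse.designerPayoff_of_stops {u : Fin 2 → Fin 2 → ℝ} {c μ₀ : ℝ}
    {I : InfoStructure μ₀} {σ : Strategy I} (h : σ.IsResponse u c) (htau : ∀ ω, σ.τ ω = 0)
    (f : Fin 2 → ℕ → ℝ) :
    σ.designerPayoff f = f (if expUtility u 0 μ₀ ≤ expUtility u 1 μ₀ then 1 else 0) 0 := by
  have := I.isProb
  have htime : ∀ ω, σ.time ω = 0 := fun ω => by simp [Strategy.time, htau ω]
  have hact : ∀ᵐ ω ∂I.law, σ.act ω = if expUtility u 0 μ₀ ≤ expUtility u 1 μ₀ then 1 else 0 := by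
    split_ifs with he
    · filter_upwards [h.actsOne] with ω hω
      refine hω ?_
      simpa [Strategy.stopBelief, htime, belief] using he
    · have hm := (σ.measurable_act (measurableSet_singleton 1)).2 0
      by_cases h1 : ∃ ω, σ.act ω = 1
      · exfalso
        obtain ⟨ω₀, hω₀⟩ := h1
        have hall : ∀ ω, σ.act ω = 1 := fun ω =>
          ((mem_iff_of_agree hm (ω := ω₀) (ω' := ω) (by simp)).1
            ⟨hω₀, show σ.τ ω₀ ≤ _ by rw [htau]; exact zero_le⟩).1
        have hle := h.stopUtility_le
        have hpay : σ.payoff u c = expUtility u 1 μ₀ := by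
          simp [Strategy.payoff, Strategy.pathPayoff, Strategy.stopBelief, htime, hall, belief]
        rw [hpay] at hle
        exact he ((le_max_left _ _).trans hle)
      · push Not at h1
        refine Filter.Eventually.of_forall fun ω => ?_
        have := h1 ω
        generalize σ.act ω = a at this
        fin_cases a
        · rfl
        · exact absurd rfl this
  have hint : σ.designerPayoff f
      = ∫ _ω, f (if expUtility u 0 μ₀ ≤ expUtility u 1 μ₀ then 1 else 0) 0 ∂I.law :=
    integral_congr_ae (hact.mono fun ω hω => by simp only [hω, htime])
  rw [hint, integral_const, probReal_univ, one_smul]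

theorem Strategy.waits_of_ae {μ₀ : ℝ} {I : InfoStructure μ₀} {σ : Strategy I}
    (h : ∀ᵐ ω ∂I.law, 0 < σ.τ ω) : ∀ ω, 0 < σ.τ ω := by
  have := I.isProb
  refine σ.stops_or_waits.resolve_left fun h0 => ?_
  obtain ⟨ω, hω⟩ := h.exists
  exact hω.ne' (h0 ω)

end AttentionCapture

theorem proposition12
    (u : Fin 2 → Fin 2 → ℝ) (c μ₀ : ℝ) (f : Fin 2 → ℕ → ℝ)
    (hu10 : u 1 0 = 0) (hu01 : u 0 1 = 0) (hu00 : 0 < u 0 0) (hu11 : 0 < u 1 1)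
    (hc : 0 < c) (hμ₀ : 0 < μ₀) (hμ₀' : μ₀ < 1)
    -- the designer prefers action 1 at every time
    (hf : ∀ t, f 0 t ≤ f 1 t)
    -- supermodularity
    (hsuper : ∀ s t, s ≤ t → f 1 s + f 0 t ≤ f 1 t + f 0 s)
    (hconcave : ∀ t, f 1 (t + 2) - f 1 (t + 1) ≤ f 1 (t + 1) - f 1 t)
    (haffine : ∃ α β : ℝ, ∀ t : ℕ, f 0 t = α + β * t)
    (hint : AttentionCapture.IntegerCondition u c μ₀) :
    -- an almost-geometric bad news structure is optimal among all information structures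
    (∃ (I : AttentionCapture.InfoStructure μ₀) (σ : AttentionCapture.Strategy I) (T : ℕ),
      σ.IsResponse u c ∧ AttentionCapture.IsAlmostGeometric u c σ T ∧
      ∀ (I' : AttentionCapture.InfoStructure μ₀) (σ' : AttentionCapture.Strategy I'),
        σ'.IsResponse u c → σ'.designerPayoff f ≤ σ.designerPayoff f) ∧
    -- optimal among the information structures under which she waits at time 0
    ((∃ (I₀ : AttentionCapture.InfoStructure μ₀) (σ₀ : AttentionCapture.Strategy I₀),
        σ₀.IsResponse u c ∧ ∀ᵐ ω ∂I₀.law, 0 < σ₀.τ ω) →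
      ∃ (I : AttentionCapture.InfoStructure μ₀) (σ : AttentionCapture.Strategy I) (T : ℕ),
        1 ≤ T ∧ σ.IsResponse u c ∧ AttentionCapture.IsAlmostGeometric u c σ T ∧
        ∀ (I' : AttentionCapture.InfoStructure μ₀) (σ' : AttentionCapture.Strategy I'),
          σ'.IsResponse u c → (∀ᵐ ω ∂I'.law, 0 < σ'.τ ω) →
            σ'.designerPayoff f ≤ σ.designerPayoff f) := by
  refine ⟨?_, ?_⟩
  · obtain ⟨I, σ, hσ, hgeo, htau⟩ := AttentionCapture.exists_stopping_structure
      hu10 hu01 hu00 hu11 hc hμ₀ hμ₀'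
    by_cases hex : ∃ (I₀ : AttentionCapture.InfoStructure μ₀) (σ₀ : AttentionCapture.Strategy I₀),
      σ₀.IsResponse u c ∧ ∀ ω, 0 < σ₀.τ ω
    · obtain ⟨I₀, σ₀, h₀, hw₀⟩ := hex
      obtain ⟨I₁, σ₁, T, -, hσ₁, hgeo₁, hopt⟩ := AttentionCapture.exists_optimal_waiting
        hu10 hu01 hu00 hu11 hc hμ₀ hμ₀' hf hsuper hconcave haffine hint h₀ hw₀
      rcases le_total (σ₁.designerPayoff f) (σ.designerPayoff f) with hle | hle
      · refine ⟨I, σ, 0, hσ, hgeo, fun I' σ' h' => ?_⟩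
        rcases σ'.stops_or_waits with hs | hw
        · rw [h'.designerPayoff_of_stops hs, hσ.designerPayoff_of_stops htau]
        · exact (hopt I' σ' h' hw).trans hle
      · refine ⟨I₁, σ₁, T, hσ₁, hgeo₁, fun I' σ' h' => ?_⟩
        rcases σ'.stops_or_waits with hs | hw
        · rw [h'.designerPayoff_of_stops hs, ← hσ.designerPayoff_of_stops htau f]
          exact hle
        · exact hopt I' σ' h' hw
    · refine ⟨I, σ, 0, hσ, hgeo, fun I' σ' h' => ?_⟩
      rcases σ'.stops_or_waits with hs | hw
      · rw [h'.designerPayoff_of_stops hs, hσ.designerPayoff_of_stops htau]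
      · exact absurd ⟨I', σ', h', hw⟩ hex
  · rintro ⟨I₀, σ₀, h₀, hw₀⟩
    obtain ⟨I, σ, T, hT, hσ, hgeo, hopt⟩ :=
      AttentionCapture.exists_optimal_waiting hu10 hu01 hu00 hu11 hc hμ₀ hμ₀' hf hsuper hconcave
        haffine hint h₀ (AttentionCapture.Strategy.waits_of_ae hw₀)
    exact ⟨I, σ, T, hT, hσ, hgeo, fun I' σ' h' hw' =>
      hopt I' σ' h' (AttentionCapture.Strategy.waits_of_ae hw')⟩
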